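/- **Setting.** Let $\mathcal{V}=(\mathcal{V},\otimes,k)$ be a commutative unital quantale with $\bot\neq k$, with internal hom $\hom$. A (strict) topological theory $\mathcal T=(\mathbb{T},\mathcal{V},\xi)$ consists of a monad $\mathbb{T}=(T,e,m)$ on $\mathbf{Set}$, the quantale $\mathcal V$ and a map $\xi:T\mathcal{V}\to\mathcal{V}$ such that: $T$ preserves weak pullbacks and the naturality squares of $m$ are weak pullbacks; $(\mathcal{V},\xi)$ is a $\mathbb{T}$-algebra, and $\otimes:\mathcal V\times\mathcal V\to\mathcal V$ and $k:1\to\mathcal V$ are $\mathbb T$-homomorphisms; and the maps $\mathcal{V}^X\to\mathcal{V}^{TX}$, $\varphi\mapsto\xi\cdot T\varphi$, are monotone and natural in $X$ with respect to the left adjoints of the inverse-image maps. Assume moreover that $T1=1$. For $\mathcal V$-relations $r:X\times Y\to\mathcal V$ and $s:Y\times Z\to\mathcal V$ write $s\cdot r(x,z)=\bigvee_y r(x,y)\otimes s(y,z)$ and $r^\circ(y,x)=r(x,y)$; identify a map with its graph (value $k$ on the graph, $\bot$ elsewhere); and put $T_\xi r(\mathfrak{x},\mathfrak{y})=\bigvee\{\xi\cdot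 Tr(\mathfrak{w})\mid \mathfrak{w}\in T(X\times Y),\,T\pi_1(\mathfrak w)=\mathfrak x,\,T\pi_2(\mathfrak w)=\mathfrak y\}$. The Kleisli convolution of $\alpha:TX\times Y\to\mathcal V$ and $\beta:TY\times Z\to\mathcal V$ is $\beta\circ\alpha=\beta\cdot T_\xi\alpha\cdot m_X^\circ$. A $\mathcal T$-graph is a set $X$ with $a:TX\times X\to\mathcal V$ satisfying $k\le a(e_X(x),x)$; it is a $\mathcal T$-category if also $T_\xi a(\mathfrak X,\mathfrak x)\otimes a(\mathfrak x,x)\le a(m_X(\mathfrak X),x)$. A morphism ($\mathcal T$-functor) $f:(X,a)\to(Y,b)$ is a map with $a(\mathfrak x,x)\le b(Tf(\mathfrak x),f(x))$; put $f_\circledast=b\cdot Tf$, $f^\circledast=f^\circ\cdot b$ and $a_0=a\cdot e_X$. $\mathcal T$-categories and $\mathcal T$-functors form the category $\mathbf{Cat}(\mathcal T)$, whose hom-sets are preordered by $f\le g\iff f^\circledast\le g^\circledast$ (equivalently $k\le b_0(f(x),g(x))$ for all $x$). Write $f\simeq g$ if $f\le g\le f$, and $f\dashv g$ if $1\le g\cdot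 f$ and $f\cdot g\le 1$. For a $\mathcal T$-category $X=(X,a)$, let $TX$ carry the structure $T_\xi a\cdot m_X^\circ\cdot m_X$. $X$ is representable if $e_X:X\to TX$ has a left adjoint in $\mathbf{Cat}(\mathcal T)$; a $\mathcal T$-functor $f:X\to Y$ between representable $\mathcal T$-categories, with left adjoints $\alpha\dashv e_X$, $\beta\dashv e_Y$, is a pseudo-homomorphism if $\beta\cdot Tf\simeq f\cdot\alpha$. Representable $\mathcal T$-categories and pseudo-homomorphisms form the (locally preordered) category $\mathbf{Repr}(\mathcal T)$. Let $G=(1,e_1^\circ)$, and let $X\otimes Y$ be $X\times Y$ with structure $(\mathfrak w,(x,y))\mapsto a(T\pi_1(\mathfrak w),x)\otimes b(T\pi_2(\mathfrak w),y)$. View $\mathcal V$ as the $\mathcal T$-graph with structure $(\mathfrak v,v)\mapsto\hom(\xi(\mathfrak v),v)$. For a $\mathcal T$-category $X=(X,a)$, let $\mathcal V^X$ be the $\mathcal T$-graph of all maps $h:X\to\mathcal V$ which are morphisms $G\otimes X\to\mathcal V$, with structure $$d(\mathfrak p,h)=\bigwedge_{\mathfrak q\in T(\mathcal V^X\times X),\,T\pi_1(\mathfrak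 q)=\mathfrak p,\;x\in X}\hom\bigl(a(T\pi_2(\mathfrak q),x),\hom(\xi\cdot T\mathrm{ev}(\mathfrak q),h(x))\bigr).$$ A $\mathcal T$-graph $(Y,d)$ is dualisable if $d_0=d\cdot e_Y$ is transitive and $d=d_0\cdot\alpha$ for some map $\alpha:TY\to Y$; its dual is $Y^{\mathrm{op}}=(Y,d_0^\circ\cdot\alpha)$, which does not depend on $\alpha$. The $\mathcal T$-graph $\mathcal V^X$ is dualisable and $VX:=(\mathcal V^X)^{\mathrm{op}}$ is a $\mathcal T$-category. Identify $\varphi\in VX$ with the $\mathcal T$-relation $\varphi\cdot e_1^\circ:T1\times X\to\mathcal V$. **Theorem.** For $\mathcal T$-functors $f:X\to Y$, the maps $Vf=f_\circledast\circ-:VX\to VY$, $y_X:X\to VX$, $x\mapsto a_0(x,-)$, and $n_X=(y_X)^\circledast\circ-:VVX\to VX$ are $\mathcal T$-functors, and: 1. $\mathbb V=(V,y,n)$ is a monad on $\mathbf{Cat}(\mathcal T)$. 2. $\mathbb V$ restricts to a monad on $\mathbf{Repr}(\mathcal T)$: if $X$ is representable, then so is $VX$, and $y_X$ and $n_X$ are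 pseudo-homomorphisms; if $f$ is a pseudo-homomorphism between representable $\mathcal T$-categories, then so is $Vf$; and these data form a monad on $\mathbf{Repr}(\mathcal T)$. 3. Both monads are of Kock–Zöberlein type: $f\le g$ implies $Vf\le Vg$, and $y_{VX}\dashv n_X\dashv V y_X$ for all $X$, in $\mathbf{Cat}(\mathcal T)$ respectively in $\mathbf{Repr}(\mathcal T)$. -/

import Mathlib

open CategoryTheory

set_option linter.unusedSectionVars false

universe u v w

/-! ## Generalities on categories whose hom-sets are preordered -/

/-- A commutative square `f ∘ p = g ∘ q` which is a weak pullback. -/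
def IsWeakPullback {C : Type u} [Category.{v} C] {W X Y Z : C}
    (p : W ⟶ X) (q : W ⟶ Y) (f : X ⟶ Z) (g : Y ⟶ Z) : Prop :=
  ∃ h : p ≫ f = q ≫ g, Nonempty (Limits.IsWeakLimit (Limits.PullbackCone.mk p q h))

/-- `f` is left adjoint to `g`, i.e. `1 ≤ g · f` and `f · g ≤ 1`. -/
def IsAdjoint {C : Type u} [Category.{v} C] [∀ X Y : C, Preorder (X ⟶ Y)] {X Y : C}
    (f : X ⟶ Y) (g : Y ⟶ X) : Prop :=
  𝟙 X ≤ f ≫ g ∧ g ≫ f ≤ 𝟙 Y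

/-- The data (without axioms) of a monad. -/
structure MonadData (C : Type u) [Category.{v} C] where
  obj : C → C
  map : ∀ {X Y : C}, (X ⟶ Y) → (obj X ⟶ obj Y)
  unit : ∀ X : C, X ⟶ obj X
  mult : ∀ X : C, obj (obj X) ⟶ obj X

/-- The data underlying a monad. -/
def CategoryTheory.Monad.data {C : Type u} [Category.{v} C] (M : Monad C) : MonadData C where
  obj := M.obj
  map := fun f => M.map f
  unit := fun X => M.η.app X
  mult := fun X => M.μ.app X

/-- A monad `M = (M, η, μ)` on a category with preordered hom-sets is of Kock-Zöberlein type
(in the variance of up-set monads) if `M` is locally monotone and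
`η_{MX} ⊣ μ_X ⊣ M η_X` for all `X`. -/
def IsKockZoberlein {C : Type u} [Category.{v} C] [∀ X Y : C, Preorder (X ⟶ Y)]
    (M : Monad C) : Prop :=
  (∀ (X Y : C) (f g : X ⟶ Y), f ≤ g → M.map f ≤ M.map g) ∧
  ∀ X : C, IsAdjoint (M.η.app (M.obj X)) (M.μ.app X) ∧
    IsAdjoint (M.μ.app X) (M.map (M.η.app X))

/-! ## Monads on sets, at the level of functions -/

namespace SetMonad

variable (T : Monad (Type u))

/-- `Tf : TX → TY` -/
def map {X Y : Type u} (f : X → Y) : T.obj X → T.obj Y := T.map (TypeCat.ofHom f)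

/-- `e_X : X → TX` -/
def e {X : Type u} : X → T.obj X := T.η.app X

/-- `m_X : TTX → TX` -/
def m {X : Type u} : T.obj (T.obj X) → T.obj X := T.μ.app X

theorem map_id {X : Type u} (x : T.obj X) : map T (fun a : X => a) x = x := by
  have h := T.map_id X
  exact congrArg (fun k : T.obj X ⟶ T.obj X => k x) h

theorem map_map {X Y Z : Type u} (f : X → Y) (g : Y → Z) (x : T.obj X) :
    map T g (map T f x) = map T (fun a => g (f a)) x := by
  have h := T.map_comp (TypeCat.ofHom f) (TypeCat.ofHom g)
  exact (congrArg (fun k : T.obj X ⟶ T.obj Z => k x) h).symm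

theorem map_e {X Y : Type u} (f : X → Y) (x : X) : map T f (e T x) = e T (f x) := by
  have h := T.η.naturality (TypeCat.ofHom f)
  exact (congrArg (fun k : X ⟶ T.obj Y => k x) h).symm

theorem map_m {X Y : Type u} (f : X → Y) (x : T.obj (T.obj X)) :
    map T f (m T x) = m T (map T (map T f) x) := by
  have h := T.μ.naturality (TypeCat.ofHom f)
  exact (congrArg (fun k : T.obj (T.obj X) ⟶ T.obj Y => k x) h).symm

theorem m_e {X : Type u} (x : T.obj X) : m T (e T x) = x :=
  congrArg (fun k : T.obj X ⟶ T.obj X => k x) (T.left_unit X)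

theorem m_map_e {X : Type u} (x : T.obj X) : m T (map T (e T) x) = x :=
  congrArg (fun k : T.obj X ⟶ T.obj X => k x) (T.right_unit X)

theorem m_map_m {X : Type u} (x : T.obj (T.obj (T.obj X))) :
    m T (map T (m T) x) = m T (m T x) :=
  congrArg (fun k : T.obj (T.obj (T.obj X)) ⟶ T.obj X => k x) (T.assoc X)

theorem isWeakPullback_iff {W X Y Z : Type u} (p : W ⟶ X) (q : W ⟶ Y) (f : X ⟶ Z) (g : Y ⟶ Z) :
    IsWeakPullback p q f g ↔
      (∀ c, f (p c) = g (q c)) ∧ ∀ a b, f a = g b → ∃ c, p c = a ∧ q c = b := by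
  constructor
  · rintro ⟨h, ⟨l⟩⟩
    refine ⟨fun c => congrArg (fun k : W ⟶ Z => k c) h, fun a b hab => ?_⟩
    have hc : (TypeCat.ofHom (fun _ : PUnit.{u+1} => a)) ≫ f
        = (TypeCat.ofHom (fun _ : PUnit.{u+1} => b)) ≫ g := by
      ext x
      exact hab
    let s := Limits.PullbackCone.mk _ _ hc
    refine ⟨l.lift s PUnit.unit, ?_, ?_⟩
    · exact congrArg (fun k : PUnit.{u+1} ⟶ X => k PUnit.unit) (l.fac s Limits.WalkingCospan.left)
    · exact congrArg (fun k : PUnit.{u+1} ⟶ Y => k PUnit.unit) (l.fac s Limits.WalkingCospan.right)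
  · rintro ⟨h, hl⟩
    have h' : p ≫ f = q ≫ g := by
      ext c
      exact h c
    refine ⟨h', ⟨?_⟩⟩
    have key : ∀ (s : Limits.PullbackCone f g) (x : s.pt), ∃ c, p c = s.fst x ∧ q c = s.snd x :=
      fun s x => hl _ _ (congrArg (fun k : s.pt ⟶ Z => k x) s.condition)
    choose l hl1 hl2 using key
    refine Limits.PullbackCone.isWeakLimitAux _ (fun s => TypeCat.ofHom (l s)) ?_ ?_
    · intro s
      ext x
      exact hl1 s x
    · intro s
      ext x
      exact hl2 s x

end SetMonad

/-! ## Topological theories -/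

/-- The left adjoint `P_V f : V^X → V^Y` of `φ ↦ φ · f`, for a map `f : X → Y`. -/
def imageSup {V : Type u} [CompleteLattice V] {X Y : Type w} (f : X → Y) (φ : X → V) : Y → V :=
  fun y => ⨆ (x : X) (_ : f x = y), φ x

/-- A (strict) topological theory `(T, V, ξ)` over the commutative unital quantale `V`
(with tensor product `*`, unit `1`). -/
structure TopologicalTheory (V : Type u) [CommMonoid V] [CompleteLattice V] [IsQuantale V] where
  /-- the monad `T = (T, e, m)` on the category of sets -/
  T : Monad (Type u)
  /-- the map `ξ : TV → V` -/
  ξ : T.obj V → V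
  /-- `T` preserves weak pullbacks -/
  preserves_weakPullback : ∀ {W X Y Z : Type u} (p : W ⟶ X) (q : W ⟶ Y) (f : X ⟶ Z) (g : Y ⟶ Z),
    IsWeakPullback p q f g → IsWeakPullback (T.map p) (T.map q) (T.map f) (T.map g)
  /-- the naturality squares of `m` are weak pullbacks -/
  mult_weakPullback : ∀ {X Y : Type u} (f : X ⟶ Y),
    IsWeakPullback (T.map (T.map f)) (T.μ.app X) (T.μ.app Y) (T.map f)
  /-- `(V, ξ)` is an Eilenberg–Moore algebra -/
  ξ_e : ∀ v : V, ξ (SetMonad.e T v) = v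
  ξ_map_ξ : ∀ x : T.obj (T.obj V), ξ (SetMonad.map T ξ x) = ξ (SetMonad.m T x)
  /-- the monoid structure of `V` lifts to `(V, ξ)` -/
  ξ_mul : ∀ x : T.obj (V × V), ξ (SetMonad.map T (fun p : V × V => p.1 * p.2) x) =
    ξ (SetMonad.map T Prod.fst x) * ξ (SetMonad.map T Prod.snd x)
  ξ_one : ∀ x : T.obj PUnit.{u + 1}, ξ (SetMonad.map T (fun _ => (1 : V)) x) = 1
  /-- the maps `V^X → V^{TX}, φ ↦ ξ · Tφ` are monotone and form a natural transformation
  `P_V → P_V T` -/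
  ξ_mono : ∀ {X : Type u} (φ ψ : X → V), φ ≤ ψ →
    (fun x => ξ (SetMonad.map T φ x)) ≤ fun x => ξ (SetMonad.map T ψ x)
  ξ_natural : ∀ {X Y : Type u} (f : X → Y) (φ : X → V),
    (fun y => ξ (SetMonad.map T (imageSup f φ) y)) =
      imageSup (SetMonad.map T f) fun x => ξ (SetMonad.map T φ x)

/-! ## `V`-relations -/

namespace VRel

variable {V : Type u} [CommMonoid V] [CompleteLattice V] {X Y Z : Type u}

/-- Composition `s · r` of the `V`-relations `r` from `X` to `Y` and `s` from `Y` to `Z`. -/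
def comp (s : Y → Z → V) (r : X → Y → V) : X → Z → V := fun x z => ⨆ y, r x y * s y z

/-- The involution `r°`. -/
def conv (r : X → Y → V) : Y → X → V := fun y x => r x y

/-- The graph of a map, with value `k = 1` if `f x = y` and `⊥` otherwise. -/
def graph (V : Type u) [CommMonoid V] [CompleteLattice V] (f : X → Y) : X → Y → V :=
  fun x y => ⨆ _ : f x = y, 1

variable [IsQuantale V]

theorem mul_iSup {ι : Sort*} (x : V) (f : ι → V) : x * ⨆ i, f i = ⨆ i, x * f i := by
  rw [← iSup_plift_down f, ← iSup_plift_down fun i => x * f i, Quantale.mul_iSup_distrib]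

theorem iSup_mul {ι : Sort*} (f : ι → V) (x : V) : (⨆ i, f i) * x = ⨆ i, f i * x := by
  rw [mul_comm, mul_iSup]
  simp only [mul_comm]

theorem comp_graph (r : Y → Z → V) (f : X → Y) (x : X) (z : Z) :
    comp r (graph V f) x z = r (f x) z := by
  simp only [comp, graph, VRel.iSup_mul, one_mul]
  exact iSup_iSup_eq_right

theorem comp_conv_graph (r : X → Z → V) (f : X → Y) (y : Y) (z : Z) :
    comp r (conv (graph V f)) y z = ⨆ (x : X) (_ : f x = y), r x z := by
  simp only [comp, conv, graph, VRel.iSup_mul, one_mul]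

theorem conv_graph_comp (r : X → Y → V) (f : Z → Y) (x : X) (z : Z) :
    comp (conv (graph V f)) r x z = r x (f z) := by
  simp only [comp, conv, graph, VRel.mul_iSup, mul_one]
  exact iSup_iSup_eq_right

end VRel

namespace TopologicalTheory

variable {V : Type u} [CommMonoid V] [CompleteLattice V] [IsQuantale V] (Th : TopologicalTheory V)
variable {X Y Z : Type u}

/-- `Tf : TX → TY` -/
abbrev map (f : X → Y) : Th.T.obj X → Th.T.obj Y := SetMonad.map Th.T f

/-- the unit `e_X : X → TX` -/
abbrev e : X → Th.T.obj X := SetMonad.e Th.T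

/-- the multiplication `m_X : TTX → TX` -/
abbrev m : Th.T.obj (Th.T.obj X) → Th.T.obj X := SetMonad.m Th.T

/-- The extension `T_ξ` of `T` to `V`-relations. -/
def ext (r : X → Y → V) : Th.T.obj X → Th.T.obj Y → V := fun x y =>
  ⨆ (w : Th.T.obj (X × Y)) (_ : Th.map Prod.fst w = x) (_ : Th.map Prod.snd w = y),
    Th.ξ (Th.map (fun p : X × Y => r p.1 p.2) w)

/-- Kleisli convolution `β ∘ α = β · T_ξ α · m_X°` of `𝕋`-relations. -/
def kleisli (β : Th.T.obj Y → Z → V) (α : Th.T.obj X → Y → V) : Th.T.obj X → Z → V :=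
  VRel.comp (VRel.comp β (Th.ext α)) (VRel.conv (VRel.graph V (Th.m (X := X))))

theorem map_id (x : Th.T.obj X) : Th.map (fun a : X => a) x = x := SetMonad.map_id _ x

theorem map_map (f : X → Y) (g : Y → Z) (x : Th.T.obj X) :
    Th.map g (Th.map f x) = Th.map (fun a => g (f a)) x := SetMonad.map_map _ f g x

theorem map_e (f : X → Y) (x : X) : Th.map f (Th.e x) = Th.e (f x) := SetMonad.map_e _ f x

theorem map_m (f : X → Y) (x : Th.T.obj (Th.T.obj X)) :
    Th.map f (Th.m x) = Th.m (Th.map (Th.map f) x) := SetMonad.map_m _ f x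

theorem m_e (x : Th.T.obj X) : Th.m (Th.e x) = x := SetMonad.m_e _ x

theorem m_map_e (x : Th.T.obj X) : Th.m (Th.map Th.e x) = x := SetMonad.m_map_e _ x

theorem m_map_m (x : Th.T.obj (Th.T.obj (Th.T.obj X))) :
    Th.m (Th.map Th.m x) = Th.m (Th.m x) := SetMonad.m_map_m _ x

theorem ξ_e' (v : V) : Th.ξ (Th.e v) = v := Th.ξ_e v

theorem ξ_map_e (φ : X → V) (x : X) : Th.ξ (Th.map φ (Th.e x)) = φ x := by
  rw [map_e, ξ_e']

theorem ξ_map_ξ' (φ : X → V) (x : Th.T.obj (Th.T.obj X)) :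
    Th.ξ (Th.map (fun t => Th.ξ (Th.map φ t)) x) = Th.ξ (Th.map φ (Th.m x)) := by
  rw [map_m, ← map_map Th (Th.map φ) Th.ξ]
  exact Th.ξ_map_ξ _

/-! Basic properties of `ξ` and of the extension `T_ξ`. -/

theorem exists_of_pullback {W A B C : Type u} (p : W → A) (q : W → B) (f : A → C) (g : B → C)
    (h : ∀ c, f (p c) = g (q c)) (hl : ∀ a b, f a = g b → ∃ c, p c = a ∧ q c = b)
    (x : Th.T.obj A) (y : Th.T.obj B) (hxy : Th.map f x = Th.map g y) :
    ∃ z, Th.map p z = x ∧ Th.map q z = y :=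
  ((SetMonad.isWeakPullback_iff _ _ _ _).1 (Th.preserves_weakPullback (TypeCat.ofHom p)
    (TypeCat.ofHom q) (TypeCat.ofHom f) (TypeCat.ofHom g)
    ((SetMonad.isWeakPullback_iff _ _ _ _).2 ⟨h, hl⟩))).2 x y hxy

theorem exists_of_m (f : X → Y) (y : Th.T.obj (Th.T.obj Y)) (x : Th.T.obj X)
    (h : Th.m y = Th.map f x) : ∃ z, Th.map (Th.map f) z = y ∧ Th.m z = x :=
  ((SetMonad.isWeakPullback_iff _ _ _ _).1 (Th.mult_weakPullback (TypeCat.ofHom f))).2 y x h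

theorem ξ_le {φ ψ : X → V} (h : ∀ x, φ x ≤ ψ x) (x : Th.T.obj X) :
    Th.ξ (Th.map φ x) ≤ Th.ξ (Th.map ψ x) := Th.ξ_mono φ ψ h x

theorem ξ_map_mul (φ ψ : X → V) (x : Th.T.obj X) :
    Th.ξ (Th.map (fun a => φ a * ψ a) x) = Th.ξ (Th.map φ x) * Th.ξ (Th.map ψ x) := by
  have := Th.ξ_mul (Th.map (fun a => (φ a, ψ a)) x)
  simpa only [map_map] using this

theorem ξ_map_one (x : Th.T.obj X) : Th.ξ (Th.map (fun _ => (1 : V)) x) = 1 := by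
  have := Th.ξ_one (Th.map (fun _ => PUnit.unit) x)
  simpa only [map_map] using this

theorem ξ_imageSup (f : X → Y) (φ : X → V) (y : Th.T.obj Y) :
    Th.ξ (Th.map (fun b => ⨆ (a : X) (_ : f a = b), φ a) y) =
      ⨆ (x : Th.T.obj X) (_ : Th.map f x = y), Th.ξ (Th.map φ x) :=
  congrFun (Th.ξ_natural f φ) y

theorem le_ext' (r : X → Y → V) (w : Th.T.obj (X × Y)) :
    Th.ξ (Th.map (fun p : X × Y => r p.1 p.2) w) ≤
      Th.ext r (Th.map Prod.fst w) (Th.map Prod.snd w) :=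
  le_iSup_of_le w (le_iSup_of_le rfl (le_iSup_of_le rfl le_rfl))

theorem le_ext (r : X → Y → V) (f : Z → X) (g : Z → Y) (z : Th.T.obj Z) :
    Th.ξ (Th.map (fun a => r (f a) (g a)) z) ≤ Th.ext r (Th.map f z) (Th.map g z) := by
  have := Th.le_ext' r (Th.map (fun a => (f a, g a)) z)
  simpa only [map_map] using this

theorem ext_le {r : X → Y → V} {x : Th.T.obj X} {y : Th.T.obj Y} {c : V}
    (h : ∀ w : Th.T.obj (X × Y), Th.map Prod.fst w = x → Th.map Prod.snd w = y →
      Th.ξ (Th.map (fun p : X × Y => r p.1 p.2) w) ≤ c) : Th.ext r x y ≤ c :=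
  iSup_le fun w => iSup_le fun h1 => iSup_le fun h2 => h w h1 h2

theorem ext_mono {r s : X → Y → V} (h : ∀ x y, r x y ≤ s x y) (x : Th.T.obj X) (y : Th.T.obj Y) :
    Th.ext r x y ≤ Th.ext s x y := by
  refine Th.ext_le fun w h1 h2 => ?_
  subst h1 h2
  exact (Th.ξ_le (fun p => h p.1 p.2) w).trans (Th.le_ext' s w)

theorem ext_map_le {X' Y' : Type u} {r : X → Y → V} {s : X' → Y' → V} (f : X → X') (g : Y → Y')
    (h : ∀ x y, r x y ≤ s (f x) (g y)) (x : Th.T.obj X) (y : Th.T.obj Y) :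
    Th.ext r x y ≤ Th.ext s (Th.map f x) (Th.map g y) := by
  refine Th.ext_le fun w h1 h2 => ?_
  subst h1 h2
  have := Th.le_ext s (fun p : X × Y => f p.1) (fun p : X × Y => g p.2) w
  simp only [map_map]
  exact (Th.ξ_le (fun p => h p.1 p.2) w).trans this

theorem ext_precomp (f : Z → X) (r : X → Y → V) (z : Th.T.obj Z) (y : Th.T.obj Y) :
    Th.ext (fun a b => r (f a) b) z y = Th.ext r (Th.map f z) y := by
  apply le_antisymm
  · have := Th.ext_map_le (r := fun a b => r (f a) b) (s := r) f (fun b => b) (fun _ _ => le_rfl) z y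
    simpa only [map_id] using this
  · refine Th.ext_le fun w h1 h2 => ?_
    obtain ⟨u, hu1, hu2⟩ := Th.exists_of_pullback (W := Z × Y) (fun p => (f p.1, p.2)) Prod.fst
      Prod.fst f (fun _ => rfl) (by rintro ⟨a, b⟩ c rfl; exact ⟨(c, b), rfl, rfl⟩) w z h1
    subst h2 hu2 hu1
    have := Th.le_ext' (fun a b => r (f a) b) u
    simpa only [map_map] using this

theorem ext_le_swap (r : X → Y → V) (x : Th.T.obj X) (y : Th.T.obj Y) :
    Th.ext r x y ≤ Th.ext (fun b a => r a b) y x := by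
  refine Th.ext_le fun w h1 h2 => ?_
  subst h1 h2
  exact Th.le_ext (fun b a => r a b) Prod.snd Prod.fst w

theorem ext_swap (r : X → Y → V) (x : Th.T.obj X) (y : Th.T.obj Y) :
    Th.ext (fun b a => r a b) y x = Th.ext r x y :=
  le_antisymm (Th.ext_le_swap (fun b a => r a b) y x) (Th.ext_le_swap r x y)

theorem ext_comp_le (r : X → Y → V) (s : Y → Z → V) (x : Th.T.obj X) (z : Th.T.obj Z) :
    Th.ext (VRel.comp s r) x z ≤ VRel.comp (Th.ext s) (Th.ext r) x z := by
  refine Th.ext_le fun w h1 h2 => ?_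
  subst h1 h2
  have h : (fun p : X × Z => VRel.comp s r p.1 p.2) = fun p => ⨆ (t : X × Y × Z)
      (_ : (t.1, t.2.2) = p), r t.1 t.2.1 * s t.2.1 t.2.2 := by
    funext p
    apply le_antisymm
    · exact iSup_le fun y => le_iSup_of_le (p.1, y, p.2) (le_iSup_of_le rfl le_rfl)
    · refine iSup_le fun t => iSup_le fun ht => ?_
      subst ht
      exact le_iSup (fun y => r t.1 y * s y t.2.2) t.2.1
  rw [h, Th.ξ_imageSup]
  refine iSup_le fun u => iSup_le fun hu => ?_
  subst hu
  rw [Th.ξ_map_mul]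
  refine le_iSup_of_le (Th.map (fun t : X × Y × Z => t.2.1) u) ?_
  simp only [map_map]
  exact mul_le_mul' (Th.le_ext r _ _ u) (Th.le_ext s _ _ u)

theorem ext_mul_le (r : X → Y → V) (s : Y → Z → V) (x : Th.T.obj X) (y : Th.T.obj Y)
    (z : Th.T.obj Z) : Th.ext r x y * Th.ext s y z ≤ Th.ext (VRel.comp s r) x z := by
  simp only [ext, VRel.mul_iSup, VRel.iSup_mul]
  refine iSup_le fun w => iSup_le fun h1 => iSup_le fun h2 =>
    iSup_le fun w' => iSup_le fun h1' => iSup_le fun h2' => ?_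
  obtain ⟨u, hu1, hu2⟩ := Th.exists_of_pullback (W := X × Y × Z) (fun t => (t.1, t.2.1))
    (fun t => t.2) Prod.snd Prod.fst (fun _ => rfl)
    (by rintro ⟨a, b⟩ ⟨b', c⟩ h; cases h; exact ⟨(a, b, c), rfl, rfl⟩) w' w (h2'.trans h1.symm)
  subst hu1 hu2 h1' h2
  have := Th.le_ext (VRel.comp s r) (fun t : X × Y × Z => t.1) (fun t => t.2.2) u
  simp only [map_map]
  refine le_trans ?_ this
  have h2 := Th.ξ_map_mul (fun t : X × Y × Z => r t.1 t.2.1) (fun t => s t.2.1 t.2.2) u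
  refine le_trans (le_of_eq h2.symm) (Th.ξ_le (fun t => ?_) u)
  exact le_iSup (fun y => r t.1 y * s y t.2.2) t.2.1

theorem ext_ext_le (r : X → Y → V) (x : Th.T.obj (Th.T.obj X)) (y : Th.T.obj (Th.T.obj Y)) :
    Th.ext (Th.ext r) x y ≤ Th.ext r (Th.m x) (Th.m y) := by
  refine Th.ext_le fun w h1 h2 => ?_
  subst h1 h2
  have h : (fun p : Th.T.obj X × Th.T.obj Y => Th.ext r p.1 p.2) = fun p =>
      ⨆ (t : Th.T.obj (X × Y)) (_ : (Th.map Prod.fst t, Th.map Prod.snd t) = p),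
        Th.ξ (Th.map (fun p : X × Y => r p.1 p.2) t) := by
    funext p
    apply le_antisymm
    · exact iSup_le fun t => iSup_le fun h1 => iSup_le fun h2 =>
        le_iSup_of_le t (le_iSup_of_le (by rw [h1, h2]) le_rfl)
    · refine iSup_le fun t => iSup_le fun ht => ?_
      subst ht
      exact Th.le_ext' r t
  rw [h, Th.ξ_imageSup]
  refine iSup_le fun u => iSup_le fun hu => ?_
  subst hu
  rw [Th.ξ_map_ξ', map_map, map_map]
  have := Th.le_ext' r (Th.m u)
  rwa [map_m Th Prod.fst, map_m Th Prod.snd] at this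

theorem ext_ext_e_le (r : X → Y → V) (x : Th.T.obj X) (y : Th.T.obj (Th.T.obj Y)) :
    Th.ext (Th.ext r) (Th.e x) y ≤ Th.ext r x (Th.m y) := by
  have h := Th.ext_ext_le r (Th.e x) y
  rwa [Th.m_e] at h

theorem ext_m_le (r : X → Y → V) (x : Th.T.obj (Th.T.obj X)) (y : Th.T.obj Y) :
    Th.ext r (Th.m x) y ≤
      ⨆ (y' : Th.T.obj (Th.T.obj Y)) (_ : Th.m y' = y), Th.ext (Th.ext r) x y' := by
  refine Th.ext_le fun w h1 h2 => ?_
  obtain ⟨u, hu1, hu2⟩ := Th.exists_of_m Prod.fst x w h1.symm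
  subst h2 hu2 hu1
  refine le_iSup_of_le (Th.map (Th.map Prod.snd) u) (le_iSup_of_le (Th.map_m _ _).symm ?_)
  rw [← Th.ξ_map_ξ']
  refine le_trans (Th.ξ_le (fun t => Th.le_ext' r t) u) ?_
  exact Th.le_ext (Th.ext r) _ _ u

theorem le_ext_e (r : X → Y → V) (x : X) (y : Y) : r x y ≤ Th.ext r (Th.e x) (Th.e y) := by
  have := Th.le_ext' r (Th.e (x, y))
  simpa only [map_e, ξ_e'] using this

theorem one_le_ext (r : X → X → V) (h : ∀ x, 1 ≤ r x x) (x : Th.T.obj X) : 1 ≤ Th.ext r x x := by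
  have := Th.le_ext r (fun a : X => a) (fun a => a) x
  simp only [map_id] at this
  rw [← Th.ξ_map_one x]
  exact (Th.ξ_le h x).trans this

theorem ext_conv_graph (f : X → Z) (r : X → Y → V) (z : Th.T.obj Z) (y : Th.T.obj Y) :
    Th.ext (fun c b => ⨆ (a : X) (_ : f a = c), r a b) z y ≤
      ⨆ (x : Th.T.obj X) (_ : Th.map f x = z), Th.ext r x y := by
  refine Th.ext_le fun w h1 h2 => ?_
  subst h1 h2
  have h : (fun p : Z × Y => ⨆ (a : X) (_ : f a = p.1), r a p.2) = fun p =>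
      ⨆ (t : X × Y) (_ : (f t.1, t.2) = p), r t.1 t.2 := by
    funext p
    apply le_antisymm
    · exact iSup_le fun a => iSup_le fun ha => le_iSup_of_le (a, p.2)
        (le_iSup_of_le (by rw [ha]) le_rfl)
    · refine iSup_le fun t => iSup_le fun ht => ?_
      subst ht
      exact le_iSup_of_le t.1 (le_iSup_of_le rfl le_rfl)
  rw [h, Th.ξ_imageSup]
  refine iSup_le fun u => iSup_le fun hu => ?_
  subst hu
  refine le_iSup_of_le (Th.map Prod.fst u) (le_iSup_of_le ?_ ?_)
  · simp only [map_map]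
  · simp only [map_map]
    exact Th.le_ext' r u

end TopologicalTheory

/-! ## `𝕋`-graphs, `𝕋`-categories and `𝕋`-functors -/

section Graphs

variable {V : Type u} [CommMonoid V] [CompleteLattice V] [IsQuantale V]

/-- A `𝕋`-graph: a set `X` with a reflexive `V`-relation `a` from `TX` to `X`. -/
structure TGraph (Th : TopologicalTheory V) where
  carrier : Type u
  rel : Th.T.obj carrier → carrier → V
  one_le_rel : ∀ x : carrier, 1 ≤ rel (Th.e x) x

/-- A `𝕋`-category is a transitive `𝕋`-graph. -/
structure TCat (Th : TopologicalTheory V) extends TGraph Th where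
  ext_mul_rel_le : ∀ (X : Th.T.obj (Th.T.obj carrier)) (x : Th.T.obj carrier) (y : carrier),
    Th.ext rel X x * rel x y ≤ rel (Th.m X) y

variable {Th : TopologicalTheory V}

namespace TGraph

/-- The underlying `V`-relation `a₀ = a · e_X`. -/
def rel₀ (X : TGraph Th) : X.carrier → X.carrier → V := fun x y => X.rel (Th.e x) y

/-- The condition `a(𝔵, x) ≤ b(Tf(𝔵), f(x))` for a map to be a morphism of `𝕋`-graphs
(a `𝕋`-functor). -/
def IsMor (X Y : TGraph Th) (f : X.carrier → Y.carrier) : Prop :=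
  ∀ (x : Th.T.obj X.carrier) (y : X.carrier), X.rel x y ≤ Y.rel (Th.map f x) (f y)

/-- The generator `G = (1, e_1°)`. -/
abbrev generator (Th : TopologicalTheory V) : TGraph Th where
  carrier := PUnit.{u + 1}
  rel := VRel.conv (VRel.graph V Th.e)
  one_le_rel := fun _ => le_iSup_of_le rfl le_rfl

/-- The tensor product `X ⊗ Y`. -/
abbrev tensor (X Y : TGraph Th) : TGraph Th where
  carrier := X.carrier × Y.carrier
  rel := fun w p => X.rel (Th.map Prod.fst w) p.1 * Y.rel (Th.map Prod.snd w) p.2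
  one_le_rel := fun p => by
    rw [Th.map_e, Th.map_e]
    exact one_le_mul (X.one_le_rel p.1) (Y.one_le_rel p.2)

/-- The `𝕋`-graph `V = (V, hom_ξ)` where `hom_ξ(𝔳, v) = hom(ξ(𝔳), v)`. -/
abbrev quantale (Th : TopologicalTheory V) : TGraph Th where
  carrier := V
  rel := fun x v => Quantale.rightMulResiduation (Th.ξ x) v
  one_le_rel := fun v => by
    rw [Quantale.rightMulResiduation_le_iff_mul_le, Th.ξ_e', mul_one]

/-- The underlying set of `Y^X`: all maps `h : X → Y` which are morphisms `G ⊗ X → Y`. -/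
abbrev ExpCarrier (X Y : TGraph Th) : Type u :=
  {h : X.carrier → Y.carrier // IsMor ((generator Th).tensor X) Y fun p => h p.2}

/-- The structure `d(𝔭, h) = ⋀ hom(a(Tπ₂(𝔮), x), b(T ev(𝔮), h(x)))` of `Y^X`, where the infimum runs
over all `𝔮 ∈ T(Y^X × X)` over `𝔭` and all `x ∈ X`. -/
def expRel (X Y : TGraph Th) (p : Th.T.obj (ExpCarrier X Y)) (h : ExpCarrier X Y) : V :=
  ⨅ (q : Th.T.obj (ExpCarrier X Y × X.carrier)) (x : X.carrier) (_ : Th.map Prod.fst q = p),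
    Quantale.rightMulResiduation (X.rel (Th.map Prod.snd q) x)
      (Y.rel (Th.map (fun t : ExpCarrier X Y × X.carrier => t.1.1 t.2) q) (h.1 x))

theorem one_le_expRel (X Y : TGraph Th) (h : ExpCarrier X Y) : 1 ≤ expRel X Y (Th.e h) h := by
  refine le_iInf fun q => le_iInf fun x => le_iInf fun hq => ?_
  rw [Quantale.rightMulResiduation_le_iff_mul_le, mul_one]
  obtain ⟨w, hw1, hw2⟩ := Th.exists_of_pullback (W := PUnit.{u + 1} × X.carrier)
    (fun p => (h, p.2)) Prod.fst (Prod.fst : ExpCarrier X Y × X.carrier → _) (fun _ => h)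
    (fun _ => rfl) (by rintro ⟨a, b⟩ c rfl; exact ⟨(c, b), rfl, rfl⟩) q (Th.e PUnit.unit)
    (by rw [hq, Th.map_e])
  subst hw1
  have := h.2 w (PUnit.unit, x)
  simp only [tensor, generator] at this
  rw [hw2] at this
  simp only [Th.map_map]
  refine le_trans ?_ this
  refine le_trans (le_of_eq (one_mul _).symm) (mul_le_mul' ?_ le_rfl)
  exact le_iSup_of_le rfl le_rfl

/-- The exponential `Y^X` in the category of `𝕋`-graphs. -/
abbrev exp (X Y : TGraph Th) : TGraph Th where
  carrier := ExpCarrier X Y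
  rel := expRel X Y
  one_le_rel := one_le_expRel X Y

/-- A `𝕋`-graph `(X, a)` is dualisable if `a₀` is transitive and `a = a₀ · α` for some map
`α : TX → X`. -/
def IsDualisable (X : TGraph Th) : Prop :=
  (∀ x y z : X.carrier, X.rel₀ x y * X.rel₀ y z ≤ X.rel₀ x z) ∧
  ∃ α : Th.T.obj X.carrier → X.carrier, X.rel = VRel.comp X.rel₀ (VRel.graph V α)

/-- The dual `X^op = (X, a₀° · α)` of a dualisable `𝕋`-graph. The relation does not depend on the
choice of `α`, see `op_rel`. -/
noncomputable abbrev op (X : TGraph Th) (hX : X.IsDualisable) : TGraph Th where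
  carrier := X.carrier
  rel := VRel.comp (VRel.conv X.rel₀) (VRel.graph V hX.2.choose)
  one_le_rel := fun x => by
    have h := hX.2.choose_spec
    have h' : ∀ z y, X.rel z y = X.rel₀ (hX.2.choose z) y := fun z y => by
      conv_lhs => rw [h]
      rw [VRel.comp_graph]
    rw [VRel.comp_graph]
    change 1 ≤ X.rel (Th.e x) _
    rw [h']
    exact X.one_le_rel _

theorem op_rel (X : TGraph Th) (hX : X.IsDualisable) (α : Th.T.obj X.carrier → X.carrier)
    (hα : X.rel = VRel.comp X.rel₀ (VRel.graph V α)) :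
    (X.op hX).rel = VRel.comp (VRel.conv X.rel₀) (VRel.graph V α) := by
  have key : ∀ α β : Th.T.obj X.carrier → X.carrier,
      X.rel = VRel.comp X.rel₀ (VRel.graph V α) → X.rel = VRel.comp X.rel₀ (VRel.graph V β) →
      ∀ x y, X.rel₀ y (α x) ≤ X.rel₀ y (β x) := by
    intro α β h1 h2 x y
    have h3 : 1 ≤ X.rel₀ (α x) (β x) := by
      have h4 : X.rel₀ (α x) (β x) = X.rel x (β x) := by
        conv_rhs => rw [h1]
        rw [VRel.comp_graph]
      have h5 : X.rel x (β x) = X.rel₀ (β x) (β x) := by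
        conv_lhs => rw [h2]
        rw [VRel.comp_graph]
      rw [h4, h5]
      exact X.one_le_rel _
    calc X.rel₀ y (α x) = X.rel₀ y (α x) * 1 := (mul_one _).symm
      _ ≤ X.rel₀ y (α x) * X.rel₀ (α x) (β x) := mul_le_mul' le_rfl h3
      _ ≤ _ := hX.1 _ _ _
  funext x y
  refine (VRel.comp_graph (VRel.conv X.rel₀) _ x y).trans
    (Eq.trans ?_ (VRel.comp_graph (VRel.conv X.rel₀) α x y).symm)
  exact le_antisymm (key _ _ hX.2.choose_spec hα x y) (key _ _ hα hX.2.choose_spec x y)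

end TGraph

namespace TCat

theorem rel_map_e (X : TCat Th) (x : Th.T.obj X.carrier) (y z : X.carrier) :
    X.rel x y * X.rel₀ y z ≤ X.rel x z := by
  have h := X.ext_mul_rel_le (Th.e x) (Th.e y) z
  rw [Th.m_e] at h
  exact (mul_le_mul' (Th.le_ext_e _ _ _) le_rfl).trans h

theorem rel₀_ext (X : TCat Th) (x y : Th.T.obj X.carrier) (z : X.carrier) :
    Th.ext X.rel₀ x y * X.rel y z ≤ X.rel x z := by
  have h := X.ext_mul_rel_le (Th.map Th.e x) y z
  rw [Th.m_map_e, ← Th.ext_precomp] at h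
  exact h

/-- The morphisms of `𝕋`-categories are the `𝕋`-functors. -/
@[ext]
structure Hom (X Y : TCat Th) where
  toFun : X.carrier → Y.carrier
  isMor : TGraph.IsMor X.toTGraph Y.toTGraph toFun

/-- The category `Cat(𝕋)` of `𝕋`-categories and `𝕋`-functors. -/
instance : Category (TCat Th) where
  Hom := Hom
  id X := ⟨fun x => x, fun x y => by rw [Th.map_id]⟩
  comp f g := ⟨fun x => g.toFun (f.toFun x), fun x y => by
    rw [← Th.map_map]
    exact (f.isMor x y).trans (g.isMor _ _)⟩

/-- The `𝕋`-relation `f_⊛ = b · Tf`. -/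
def lowerStar {X Y : TCat Th} (f : X ⟶ Y) : Th.T.obj X.carrier → Y.carrier → V :=
  VRel.comp Y.rel (VRel.graph V (Th.map f.toFun))

/-- The `𝕋`-relation `f^⊛ = f° · b`. -/
def upperStar {X Y : TCat Th} (f : X ⟶ Y) : Th.T.obj Y.carrier → X.carrier → V :=
  VRel.comp (VRel.conv (VRel.graph V f.toFun)) Y.rel

/-- The order on `𝕋`-functors: `f ≤ g` if `f^⊛ ≤ g^⊛`. -/
instance (X Y : TCat Th) : Preorder (X ⟶ Y) where
  le f g := upperStar f ≤ upperStar g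
  le_refl f := le_refl (upperStar f)
  le_trans f g h := fun h1 h2 => le_trans (α := Th.T.obj Y.carrier → X.carrier → V) h1 h2

theorem le_iff {X Y : TCat Th} (f g : X ⟶ Y) :
    f ≤ g ↔ ∀ x, 1 ≤ Y.rel₀ (f.toFun x) (g.toFun x) := by
  have h0 : f ≤ g ↔ ∀ x y, Y.rel x (f.toFun y) ≤ Y.rel x (g.toFun y) := by
    change upperStar f ≤ upperStar g ↔ _
    simp only [Pi.le_def, upperStar, VRel.conv_graph_comp]
  rw [h0]
  constructor
  · intro h x
    exact (Y.one_le_rel _).trans (h _ _)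
  · intro h x y
    calc Y.rel x (f.toFun y) = Y.rel x (f.toFun y) * 1 := (mul_one _).symm
      _ ≤ Y.rel x (f.toFun y) * Y.rel₀ (f.toFun y) (g.toFun y) := mul_le_mul' le_rfl (h y)
      _ ≤ _ := Y.rel_map_e _ _ _

theorem comp_le_comp {X Y Z : TCat Th} {f f' : X ⟶ Y} {g g' : Y ⟶ Z} (hf : f ≤ f') (hg : g ≤ g') :
    f ≫ g ≤ f' ≫ g' := by
  rw [le_iff] at hf hg ⊢
  intro x
  have h1 := (hf x).trans (g.isMor _ _)
  rw [Th.map_e] at h1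
  have h2 := Z.rel_map_e (Th.e (g.toFun (f.toFun x))) (g.toFun (f'.toFun x))
    (g'.toFun (f'.toFun x))
  exact (one_le_mul h1 (hg _)).trans h2

/-! ## The monad `𝕋` on `Cat(𝕋)` and representable `𝕋`-categories -/

/-- The relation `â = T_ξ a · m_X°` on `TX`. -/
def hat (X : TCat Th) : Th.T.obj X.carrier → Th.T.obj X.carrier → V :=
  VRel.comp (Th.ext X.rel) (VRel.conv (VRel.graph V Th.m))

theorem hat_apply (X : TCat Th) (x y : Th.T.obj X.carrier) :
    X.hat x y = ⨆ (z : Th.T.obj (Th.T.obj X.carrier)) (_ : Th.m z = x), Th.ext X.rel z y :=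
  VRel.comp_conv_graph _ _ _ _

theorem le_hat (X : TCat Th) (z : Th.T.obj (Th.T.obj X.carrier)) (y : Th.T.obj X.carrier) :
    Th.ext X.rel z y ≤ X.hat (Th.m z) y := by
  rw [hat_apply]
  exact le_iSup_of_le z (le_iSup_of_le rfl le_rfl)

theorem ext_ext_mul_ext_le (X : TCat Th) (x : Th.T.obj (Th.T.obj (Th.T.obj X.carrier)))
    (y : Th.T.obj (Th.T.obj X.carrier)) (z : Th.T.obj X.carrier) :
    Th.ext (Th.ext X.rel) x y * Th.ext X.rel y z ≤ Th.ext X.rel (Th.map Th.m x) z := by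
  refine (Th.ext_mul_le _ _ _ _ _).trans ?_
  rw [← Th.ext_precomp]
  exact Th.ext_mono (fun a b => iSup_le fun c => X.ext_mul_rel_le a c b) _ _

theorem hat_trans (X : TCat Th) (x y z : Th.T.obj X.carrier) :
    X.hat x y * X.hat y z ≤ X.hat x z := by
  rw [hat_apply X x y, hat_apply X y z]
  simp only [VRel.mul_iSup, VRel.iSup_mul]
  refine iSup_le fun b => iSup_le fun hb => iSup_le fun a => iSup_le fun ha => ?_
  subst ha hb
  have h : Th.ext X.rel a (Th.m b) ≤ ⨆ (c : _) (_ : Th.m c = a), Th.ext (Th.ext X.rel) c b := by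
    rw [← Th.ext_swap]
    refine (Th.ext_m_le _ _ _).trans (le_of_eq ?_)
    refine iSup_congr fun c => iSup_congr fun hc => ?_
    rw [← Th.ext_swap]
    congr 1
    funext s t
    exact Th.ext_swap _ _ _
  refine (mul_le_mul' h le_rfl).trans ?_
  simp only [VRel.iSup_mul]
  refine iSup_le fun c => iSup_le fun hc => ?_
  subst hc
  rw [← Th.m_map_m]
  exact (X.ext_ext_mul_ext_le c b z).trans (X.le_hat _ _)

theorem ext_hat_le (X : TCat Th) (x y : Th.T.obj (Th.T.obj X.carrier)) :
    Th.ext X.hat x y ≤ X.hat (Th.m x) (Th.m y) := by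
  have h : X.hat = fun x y => ⨆ (z : Th.T.obj (Th.T.obj X.carrier)) (_ : Th.m z = x),
      Th.ext X.rel z y := by
    funext x y
    exact X.hat_apply x y
  have h2 := Th.ext_conv_graph Th.m (Th.ext X.rel) x y
  rw [← h] at h2
  refine h2.trans (iSup_le fun z => iSup_le fun hz => ?_)
  subst hz
  rw [Th.m_map_m]
  exact (Th.ext_ext_le _ _ _).trans (X.le_hat _ _)

theorem one_le_hat (X : TCat Th) (x : Th.T.obj X.carrier) : 1 ≤ X.hat x x := by
  have h := Th.one_le_ext X.rel₀ X.one_le_rel x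
  have h2 : Th.ext X.rel₀ x x = Th.ext X.rel (Th.map Th.e x) x :=
    Th.ext_precomp Th.e X.rel x x
  rw [h2] at h
  have h3 := h.trans (X.le_hat _ _)
  rwa [Th.m_map_e] at h3

/-- The `𝕋`-category `TX = (TX, T_ξ a · m_X° · m_X)`. -/
abbrev T (X : TCat Th) : TCat Th where
  carrier := Th.T.obj X.carrier
  rel := VRel.comp X.hat (VRel.graph V Th.m)
  one_le_rel := fun x => by
    rw [VRel.comp_graph, Th.m_e]
    exact X.one_le_hat x
  ext_mul_rel_le := fun x y z => by
    have h : VRel.comp X.hat (VRel.graph V Th.m) = fun x y => X.hat (Th.m x) y := by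
      funext x y
      exact VRel.comp_graph _ _ _ _
    rw [h]
    dsimp only
    rw [Th.ext_precomp]
    refine (mul_le_mul' (X.ext_hat_le _ _) le_rfl).trans ?_
    rw [← Th.m_map_m]
    exact X.hat_trans _ _ _

theorem T_rel (X : TCat Th) (x : Th.T.obj (Th.T.obj X.carrier)) (y : Th.T.obj X.carrier) :
    X.T.rel x y = X.hat (Th.m x) y := VRel.comp_graph _ _ _ _

/-- The `𝕋`-functor `Tf : TX → TY`. -/
def mapT {X Y : TCat Th} (f : X ⟶ Y) : X.T ⟶ Y.T where
  toFun := Th.map f.toFun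
  isMor := fun x y => by
    have h : ∀ (x : Th.T.obj (Th.T.obj X.carrier)) (y : Th.T.obj X.carrier),
        X.hat (Th.m x) y ≤ Y.hat (Th.m (Th.map (Th.map f.toFun) x)) (Th.map f.toFun y) := by
      intro x y
      rw [← Th.map_m, hat_apply]
      refine iSup_le fun z => iSup_le fun hz => ?_
      rw [← hz, Th.map_m]
      exact (Th.ext_map_le _ _ f.isMor z y).trans (Y.le_hat _ _)
    exact (X.T_rel x y).le.trans ((h x y).trans (Y.T_rel _ _).ge)

/-- The `𝕋`-functor `e_X : X → TX`. -/
def unitT (X : TCat Th) : X ⟶ X.T where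
  toFun := Th.e
  isMor := fun x y => by
    have h := (Th.le_ext_e X.rel x y).trans (X.le_hat _ _)
    rw [Th.m_e] at h
    refine (h.trans (le_of_eq ?_)).trans (X.T_rel _ _).ge
    exact congrArg (fun z => X.hat z (Th.e y)) (Th.m_map_e x).symm

/-- A `𝕋`-category `X` is representable if `e_X : X → TX` has a left adjoint in `Cat(𝕋)`. -/
def IsRepresentable (X : TCat Th) : Prop := ∃ α : X.T ⟶ X, IsAdjoint α X.unitT

/-- A `𝕋`-functor `f` between representable `𝕋`-categories, with left adjoints `α : TX → X` and
`β : TY → Y` of the units, is a pseudo-homomorphism if `β · Tf ≃ f · α`. -/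
def IsPseudoHom {X Y : TCat Th} (f : X ⟶ Y) : Prop :=
  ∀ (α : X.T ⟶ X) (β : Y.T ⟶ Y), IsAdjoint α X.unitT → IsAdjoint β Y.unitT →
    AntisymmRel (· ≤ ·) (mapT f ≫ β) (α ≫ f)

theorem adjoint_le {X Y : TCat Th} {f f' : X ⟶ Y} {g : Y ⟶ X} (h : IsAdjoint f g)
    (h' : IsAdjoint f' g) : f ≤ f' := by
  have h1 : f ≤ f' ≫ g ≫ f := by
    have := comp_le_comp h'.1 (le_refl f)
    rwa [Category.id_comp, Category.assoc] at this
  have h2 : f' ≫ g ≫ f ≤ f' := by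
    have := comp_le_comp (le_refl f') h.2
    rwa [Category.comp_id] at this
  exact h1.trans h2

theorem mapT_id (X : TCat Th) : mapT (𝟙 X) = 𝟙 X.T :=
  Hom.ext (funext fun x => Th.map_id x)

theorem mapT_comp {X Y Z : TCat Th} (f : X ⟶ Y) (g : Y ⟶ Z) : mapT (f ≫ g) = mapT f ≫ mapT g :=
  Hom.ext (funext fun x => (Th.map_map f.toFun g.toFun x).symm)

theorem isPseudoHom_id (X : TCat Th) : IsPseudoHom (𝟙 X) := by
  intro α β hα hβ
  rw [mapT_id, Category.id_comp, Category.comp_id]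
  exact ⟨adjoint_le hβ hα, adjoint_le hα hβ⟩

theorem isPseudoHom_comp {X Y Z : TCat Th} {f : X ⟶ Y} {g : Y ⟶ Z} (hY : Y.IsRepresentable)
    (hf : IsPseudoHom f) (hg : IsPseudoHom g) : IsPseudoHom (f ≫ g) := by
  intro α γ hα hγ
  obtain ⟨β, hβ⟩ := hY
  have h1 := hf α β hα hβ
  have h2 := hg β γ hβ hγ
  rw [mapT_comp]
  constructor
  · calc (mapT f ≫ mapT g) ≫ γ = mapT f ≫ (mapT g ≫ γ) := Category.assoc _ _ _
      _ ≤ mapT f ≫ (β ≫ g) := comp_le_comp le_rfl h2.1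
      _ = (mapT f ≫ β) ≫ g := (Category.assoc _ _ _).symm
      _ ≤ (α ≫ f) ≫ g := comp_le_comp h1.1 le_rfl
      _ = α ≫ f ≫ g := Category.assoc _ _ _
  · calc α ≫ f ≫ g = (α ≫ f) ≫ g := (Category.assoc _ _ _).symm
      _ ≤ (mapT f ≫ β) ≫ g := comp_le_comp h1.2 le_rfl
      _ = mapT f ≫ (β ≫ g) := Category.assoc _ _ _
      _ ≤ mapT f ≫ (mapT g ≫ γ) := comp_le_comp le_rfl h2.2
      _ = (mapT f ≫ mapT g) ≫ γ := (Category.assoc _ _ _).symm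

end TCat

/-- Representable `𝕋`-categories. -/
structure TRepr (Th : TopologicalTheory V) where
  toTCat : TCat Th
  isRepresentable : toTCat.IsRepresentable

namespace TRepr

/-- Pseudo-homomorphisms of representable `𝕋`-categories. -/
@[ext]
structure Hom (X Y : TRepr Th) where
  hom : X.toTCat ⟶ Y.toTCat
  isPseudoHom : TCat.IsPseudoHom hom

/-- The category `Repr(𝕋)` of representable `𝕋`-categories and pseudo-homomorphisms. -/
instance : Category (TRepr Th) where
  Hom := Hom
  id X := ⟨𝟙 X.toTCat, TCat.isPseudoHom_id _⟩
  comp {_ Y _} f g := ⟨f.hom ≫ g.hom,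
    TCat.isPseudoHom_comp Y.isRepresentable f.isPseudoHom g.isPseudoHom⟩

/-- The order on pseudo-homomorphisms is the one of `Cat(𝕋)`. -/
instance (X Y : TRepr Th) : Preorder (X ⟶ Y) := Preorder.lift fun f : X ⟶ Y => Hom.hom f

end TRepr

end Graphs

/-! ## The `𝕋`-category `VX = (V^X)^op` -/

section Vietoris

variable {V : Type u} [CommMonoid V] [CompleteLattice V] [IsQuantale V]
variable {Th : TopologicalTheory V}

/-- The `𝕋`-graph `V^X`. -/
abbrev TCat.power (X : TCat Th) : TGraph Th := X.toTGraph.exp (TGraph.quantale Th)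

/-- A `V`-relation `φ` from `1` to `Y`, viewed as the `𝕋`-relation `φ · e_1°`. -/
def TCat.ofPoint (Th : TopologicalTheory V) {Y : Type u} (φ : Y → V) :
    Th.T.obj PUnit.{u + 1} → Y → V :=
  VRel.comp (fun (_ : PUnit.{u + 1}) y => φ y) (VRel.conv (VRel.graph V Th.e))

/-- For a `𝕋`-relation `ψ` from `Y` to `Z` and `φ : Y → V`, viewed as a `𝕋`-relation from `1` to
`Y`, the Kleisli convolution `ψ ∘ φ`, viewed as a map `Z → V`. -/
def TCat.act {Th : TopologicalTheory V} {Y Z : Type u} (ψ : Th.T.obj Y → Z → V) (φ : Y → V) :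
    Z → V :=
  fun z => Th.kleisli ψ (TCat.ofPoint Th φ) (Th.e PUnit.unit) z

namespace TCat

variable [hT : Subsingleton (Th.T.obj PUnit.{u + 1})]

theorem ofPoint_apply {Y : Type u} (φ : Y → V) (t : Th.T.obj PUnit.{u + 1}) (y : Y) :
    ofPoint Th φ t y = φ y := by
  rw [ofPoint, VRel.comp_conv_graph]
  apply le_antisymm
  · exact iSup_le fun _ => iSup_le fun _ => le_rfl
  · exact le_iSup_of_le PUnit.unit (le_iSup_of_le (Subsingleton.elim _ _) le_rfl)

theorem ξ_map_const {Y : Type u} (u : V) (y : Th.T.obj Y) : Th.ξ (Th.map (fun _ => u) y) = u := by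
  have h := Th.map_map (fun _ => PUnit.unit.{u + 1}) (fun _ => u) y
  rw [← h, Subsingleton.elim (Th.map (fun _ => PUnit.unit.{u + 1}) y) (Th.e PUnit.unit), Th.map_e,
    Th.ξ_e']

theorem ext_const {A Y : Type u} [Subsingleton (Th.T.obj A)] (a : A) (φ : Y → V)
    (t : Th.T.obj A) (y : Th.T.obj Y) :
    Th.ext (fun (_ : A) y => φ y) t y = Th.ξ (Th.map φ y) := by
  apply le_antisymm
  · refine Th.ext_le fun w h1 h2 => ?_
    subst h2
    rw [Th.map_map]
  · have h := Th.le_ext (fun (_ : A) y => φ y) (fun _ => a) (fun y : Y => y) y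
    rwa [Th.map_id, Subsingleton.elim (Th.map (fun _ => a) y) t] at h

theorem act_apply {Y Z : Type u} (ψ : Th.T.obj Y → Z → V) (φ : Y → V) (z : Z) :
    act ψ φ z = ⨆ y : Th.T.obj Y, Th.ξ (Th.map φ y) * ψ y z := by
  have h : ofPoint Th φ = fun _ y => φ y := by
    funext t y
    exact ofPoint_apply φ t y
  have h1 : ∀ t : Th.T.obj PUnit.{u + 1}, Th.e PUnit.unit = t := fun t => Subsingleton.elim _ _
  have hTT : Subsingleton (Th.T.obj (Th.T.obj PUnit.{u + 1})) := by
    refine ⟨fun x y => ?_⟩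
    have hx : ∀ x : Th.T.obj (Th.T.obj PUnit.{u + 1}),
        x = Th.map Th.e (Th.map (fun _ => PUnit.unit) x) := by
      intro x
      conv_lhs => rw [← Th.map_id x]
      rw [Th.map_map]
      congr 1
      funext t
      exact (h1 t).symm
    rw [hx x, hx y, Subsingleton.elim (Th.map (fun _ => PUnit.unit.{u + 1}) x)]
  rw [act, TopologicalTheory.kleisli, VRel.comp_conv_graph, h]
  have h2 : ∀ t : Th.T.obj (Th.T.obj PUnit.{u + 1}),
      VRel.comp ψ (Th.ext fun (_ : Th.T.obj PUnit.{u + 1}) y => φ y) t z =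
        ⨆ y : Th.T.obj Y, Th.ξ (Th.map φ y) * ψ y z := by
    intro t
    refine iSup_congr fun y => ?_
    rw [ext_const (Th.e PUnit.unit)]
  simp only [h2]
  apply le_antisymm
  · exact iSup_le fun _ => iSup_le fun _ => le_rfl
  · exact le_iSup_of_le (Th.e (Th.e PUnit.unit)) (le_iSup_of_le (Subsingleton.elim _ _) le_rfl)

theorem mem_power_iff (X : TCat Th) (φ : X.carrier → V) :
    TGraph.IsMor ((TGraph.generator Th).tensor X.toTGraph) (TGraph.quantale Th)
      (fun p => φ p.2) ↔
    ∀ (x : Th.T.obj X.carrier) (y : X.carrier), Th.ξ (Th.map φ x) * X.rel x y ≤ φ y := by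
  constructor
  · intro h x y
    have h1 := h (Th.map (fun a => (PUnit.unit, a)) x) (PUnit.unit, y)
    simp only [TGraph.tensor, TGraph.generator, TGraph.quantale] at h1
    rw [Quantale.rightMulResiduation_le_iff_mul_le, Th.map_map, Th.map_map, Th.map_map, Th.map_id]
      at h1
    refine le_trans (mul_le_mul' le_rfl ?_) h1
    refine le_trans (le_of_eq (one_mul _).symm) (mul_le_mul' ?_ le_rfl)
    exact le_iSup_of_le (Subsingleton.elim _ _) le_rfl
  · intro h w p
    simp only [TGraph.tensor, TGraph.generator, TGraph.quantale]
    rw [Quantale.rightMulResiduation_le_iff_mul_le]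
    refine le_trans (mul_le_mul' le_rfl (mul_le_mul' (b := 1) ?_ le_rfl)) ?_
    · exact iSup_le fun _ => le_rfl
    · rw [one_mul]
      have h1 := h (Th.map Prod.snd w) p.2
      rwa [Th.map_map] at h1

/-- The evaluation map as a `V`-relation from `V^X` to `X`. -/
def ev (X : TCat Th) : X.power.carrier → X.carrier → V := fun φ x => φ.1 x

/-- The `V`-relation `μ = a · T_ξ ev`. -/
def mu (X : TCat Th) : Th.T.obj X.power.carrier → X.carrier → V :=
  VRel.comp X.rel (Th.ext X.ev)

theorem le_mu (X : TCat Th) (p : Th.T.obj X.power.carrier) (x : Th.T.obj X.carrier)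
    (y : X.carrier) : Th.ext X.ev p x * X.rel x y ≤ X.mu p y :=
  le_iSup (fun x => Th.ext X.ev p x * X.rel x y) x

theorem ext_mu_mul_le (X : TCat Th) (p : Th.T.obj (Th.T.obj X.power.carrier))
    (x : Th.T.obj X.carrier) (y : X.carrier) :
    Th.ext X.mu p x * X.rel x y ≤ X.mu (Th.m p) y := by
  refine (mul_le_mul' (Th.ext_comp_le _ _ p x) le_rfl).trans ?_
  simp only [VRel.comp, VRel.iSup_mul]
  refine iSup_le fun z => ?_
  rw [mul_assoc]
  exact (mul_le_mul' (Th.ext_ext_le _ _ _) (X.ext_mul_rel_le _ _ _)).trans (X.le_mu _ _ _)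

theorem ξ_mu_le (X : TCat Th) (p : Th.T.obj X.power.carrier) (x : Th.T.obj X.carrier) :
    Th.ξ (Th.map (X.mu p) x) ≤ Th.ext X.mu (Th.e p) x := by
  have h := Th.ext_precomp (fun _ : PUnit.{u + 1} => p) X.mu (Th.e PUnit.unit) x
  rw [ext_const PUnit.unit, Th.map_e] at h
  exact h.le

theorem mu_mem (X : TCat Th) (p : Th.T.obj X.power.carrier) :
    TGraph.IsMor ((TGraph.generator Th).tensor X.toTGraph) (TGraph.quantale Th)
      (fun q => X.mu p q.2) := by
  rw [mem_power_iff]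
  intro x y
  refine (mul_le_mul' (X.ξ_mu_le p x) le_rfl).trans ((X.ext_mu_mul_le _ _ _).trans ?_)
  rw [Th.m_e]

theorem power_rel (X : TCat Th) (p : Th.T.obj X.power.carrier) (h : X.power.carrier) :
    X.power.rel p h = ⨅ x, Quantale.rightMulResiduation (X.mu p x) (h.1 x) := by
  apply le_antisymm
  · refine le_iInf fun x => ?_
    rw [Quantale.rightMulResiduation_le_iff_mul_le]
    simp only [mu, VRel.comp, VRel.iSup_mul]
    refine iSup_le fun y => ?_
    rw [mul_assoc, mul_comm]
    rw [← Quantale.rightMulResiduation_le_iff_mul_le]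
    refine Th.ext_le fun w h1 h2 => ?_
    subst h2
    rw [Quantale.rightMulResiduation_le_iff_mul_le]
    have h3 : X.power.rel p h ≤ Quantale.rightMulResiduation (X.rel (Th.map Prod.snd w) x)
        (Quantale.rightMulResiduation
          (Th.ξ (Th.map (fun t : X.power.carrier × X.carrier => t.1.1 t.2) w)) (h.1 x)) :=
      iInf_le_of_le w (iInf_le_of_le x (iInf_le_of_le h1 le_rfl))
    rw [Quantale.rightMulResiduation_le_iff_mul_le,
      Quantale.rightMulResiduation_le_iff_mul_le] at h3
    rw [mul_comm]
    exact h3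
  · refine le_iInf fun w => le_iInf fun x => le_iInf fun h1 => ?_
    subst h1
    rw [Quantale.rightMulResiduation_le_iff_mul_le]
    change _ ≤ Quantale.rightMulResiduation
      (Th.ξ (Th.map (fun t : X.power.carrier × X.carrier => t.1.1 t.2) w)) (h.1 x)
    rw [Quantale.rightMulResiduation_le_iff_mul_le, ← mul_assoc]
    refine (mul_le_mul' ?_ (iInf_le _ x)).trans
      (Quantale.rightMulResiduation_le_iff_mul_le.1 le_rfl)
    exact (mul_le_mul' (Th.le_ext' X.ev w) le_rfl).trans (X.le_mu _ _ _)

theorem mu_e (X : TCat Th) (φ : X.power.carrier) (x : X.carrier) : X.mu (Th.e φ) x = φ.1 x := by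
  apply le_antisymm
  · have h := (mem_power_iff X φ.1).1 φ.2
    refine iSup_le fun y => ?_
    refine le_trans (mul_le_mul' ?_ le_rfl) (h y x)
    have h1 := Th.ext_precomp (fun _ : PUnit.{u + 1} => φ) X.ev (Th.e PUnit.unit) y
    rw [Th.map_e] at h1
    rw [← h1]
    exact (ext_const PUnit.unit φ.1 _ _).le
  · have h1 : 1 ≤ X.rel (Th.e x) x := X.one_le_rel x
    refine le_trans ?_ (X.le_mu (Th.e φ) (Th.e x) x)
    refine le_trans (le_of_eq (mul_one _).symm) (mul_le_mul' (Th.le_ext_e X.ev φ x) h1)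

theorem power_rel₀ (X : TCat Th) (φ ψ : X.power.carrier) :
    X.power.rel₀ φ ψ = ⨅ x, Quantale.rightMulResiduation (φ.1 x) (ψ.1 x) := by
  refine (X.power_rel _ _).trans (iInf_congr fun x => ?_)
  exact congrArg (fun v => Quantale.rightMulResiduation v (ψ.1 x)) (X.mu_e φ x)

theorem power_eq (X : TCat Th) : X.power.rel =
    VRel.comp X.power.rel₀ (VRel.graph V fun p => ⟨X.mu p, X.mu_mem p⟩) := by
  funext p h
  rw [VRel.comp_graph, power_rel, power_rel₀]

theorem power_isDualisable (X : TCat Th) : X.power.IsDualisable := by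
  refine ⟨fun φ ψ χ => ?_, _, X.power_eq⟩
  rw [power_rel₀, power_rel₀, power_rel₀]
  refine le_iInf fun x => ?_
  rw [Quantale.rightMulResiduation_le_iff_mul_le, ← mul_assoc]
  refine (mul_le_mul' (mul_le_mul' le_rfl (iInf_le _ x)) (iInf_le _ x)).trans ?_
  refine (mul_le_mul' (Quantale.rightMulResiduation_le_iff_mul_le.1 le_rfl) le_rfl).trans ?_
  exact Quantale.rightMulResiduation_le_iff_mul_le.1 le_rfl

theorem op_power_rel (X : TCat Th) (p : Th.T.obj X.power.carrier) (h : X.power.carrier) :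
    (X.power.op X.power_isDualisable).rel p h =
      ⨅ x, Quantale.rightMulResiduation (h.1 x) (X.mu p x) := by
  rw [X.power.op_rel X.power_isDualisable _ X.power_eq]
  exact (VRel.comp_graph _ _ _ _).trans (X.power_rel₀ _ _)

theorem le_op_power_rel_iff (X : TCat Th) (p : Th.T.obj X.power.carrier) (h : X.power.carrier)
    (c : V) : c ≤ (X.power.op X.power_isDualisable).rel p h ↔ ∀ x, h.1 x * c ≤ X.mu p x := by
  rw [op_power_rel, le_iInf_iff]
  exact forall_congr' fun x => Quantale.rightMulResiduation_le_iff_mul_le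

theorem ev_mul_le (X : TCat Th) (p : Th.T.obj X.power.carrier) (h : X.power.carrier)
    (x : X.carrier) :
    (X.power.op X.power_isDualisable).rel p h * h.1 x ≤ X.mu p x := by
  rw [mul_comm]
  exact (X.le_op_power_rel_iff p h _).1 le_rfl x

theorem ext_op_mul_mu_le (X : TCat Th) (P : Th.T.obj (Th.T.obj X.power.carrier))
    (p : Th.T.obj X.power.carrier) (x : X.carrier) :
    Th.ext (X.power.op X.power_isDualisable).rel P p * X.mu p x ≤ X.mu (Th.m P) x := by
  conv_lhs => rw [mu]
  rw [VRel.comp, VRel.mul_iSup]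
  refine iSup_le fun y => ?_
  rw [← mul_assoc]
  refine (mul_le_mul' (Th.ext_mul_le _ _ _ _ _) le_rfl).trans ?_
  refine (mul_le_mul' (Th.ext_mono (s := X.mu) (fun q z => ?_) P y) le_rfl).trans
    (X.ext_mu_mul_le _ _ _)
  exact iSup_le fun h => X.ev_mul_le q h z

/-- The `𝕋`-category `VX = (V^X)^op`. -/
noncomputable abbrev vietoris (X : TCat Th) : TCat Th where
  toTGraph := X.power.op X.power_isDualisable
  ext_mul_rel_le := fun P p h => by
    refine (X.le_op_power_rel_iff _ h _).2 fun x => ?_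
    rw [mul_left_comm]
    refine (mul_le_mul' le_rfl ((X.le_op_power_rel_iff p h _).1 le_rfl x)).trans ?_
    exact X.ext_op_mul_mu_le P p x

theorem act_mem {X Y : TCat Th} (ψ : Th.T.obj X.carrier → Y.carrier → V)
    (hψ : ∀ (P : Th.T.obj (Th.T.obj X.carrier)) (y : Th.T.obj Y.carrier) (z : Y.carrier),
      Th.ext ψ P y * Y.rel y z ≤ ψ (Th.m P) z) (φ : X.carrier → V) :
    TGraph.IsMor ((TGraph.generator Th).tensor Y.toTGraph) (TGraph.quantale Th)
      (fun p => act ψ φ p.2) := by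
  rw [mem_power_iff]
  intro y z
  have h : act ψ φ = fun y => ⨆ x : Th.T.obj X.carrier, Th.ξ (Th.map φ x) * ψ x y := by
    funext y
    exact act_apply ψ φ y
  have h1 : Th.ξ (Th.map (act ψ φ) y) ≤
      ⨆ P : Th.T.obj (Th.T.obj X.carrier), Th.ξ (Th.map φ (Th.m P)) * Th.ext ψ P y := by
    rw [h]
    have h2 := Th.ext_comp_le (fun (_ : PUnit.{u + 1}) x => Th.ξ (Th.map φ x)) ψ
      (Th.e PUnit.unit) y
    have h3 := (ext_const PUnit.unit (fun y => ⨆ x : Th.T.obj X.carrier,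
      Th.ξ (Th.map φ x) * ψ x y) (Th.e PUnit.unit) y).ge.trans h2
    refine h3.trans (iSup_mono fun P => ?_)
    rw [ext_const PUnit.unit, Th.ξ_map_ξ']
  refine (mul_le_mul' h1 le_rfl).trans ?_
  rw [VRel.iSup_mul]
  refine iSup_le fun P => ?_
  rw [mul_assoc, act_apply]
  refine (mul_le_mul' le_rfl (hψ P y z)).trans ?_
  exact le_iSup (fun x => Th.ξ (Th.map φ x) * ψ x z) (Th.m P)

theorem lowerStar_apply {X Y : TCat Th} (f : X ⟶ Y) (x : Th.T.obj X.carrier) (y : Y.carrier) :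
    lowerStar f x y = Y.rel (Th.map f.toFun x) y := VRel.comp_graph _ _ _ _

theorem lowerStar_dist {X Y : TCat Th} (f : X ⟶ Y) (P : Th.T.obj (Th.T.obj X.carrier))
    (y : Th.T.obj Y.carrier) (z : Y.carrier) :
    Th.ext (lowerStar f) P y * Y.rel y z ≤ lowerStar f (Th.m P) z := by
  have h : lowerStar f = fun x y => Y.rel (Th.map f.toFun x) y := by
    funext x y
    exact lowerStar_apply f x y
  rw [h]
  dsimp only
  rw [Th.ext_precomp, Th.map_m]
  exact Y.ext_mul_rel_le _ _ _

theorem mul_act_le {X Y : TCat Th} (ψ : Th.T.obj X.carrier → Y.carrier → V) (c : V)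
    (φ χ : X.carrier → V) (h : ∀ x, φ x * c ≤ χ x) (y : Y.carrier) :
    act ψ φ y * c ≤ act ψ χ y := by
  rw [act_apply, act_apply, VRel.iSup_mul]
  refine iSup_mono fun x => ?_
  rw [mul_right_comm]
  refine mul_le_mul' ?_ le_rfl
  have h1 := Th.ξ_map_mul φ (fun _ => c) x
  rw [ξ_map_const] at h1
  rw [← h1]
  exact Th.ξ_le h x

/-- The `𝕋`-functor `Vf = f_⊛ ∘ - : VX → VY`. -/
noncomputable def vietorisMap {X Y : TCat Th} (f : X ⟶ Y) : X.vietoris ⟶ Y.vietoris where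
  toFun := fun φ => ⟨act (lowerStar f) φ.1, act_mem _ (lowerStar_dist f) _⟩
  isMor := fun p φ => by
    refine (Y.le_op_power_rel_iff _ _ _).2 fun y => ?_
    refine (mul_act_le (lowerStar f) _ φ.1 (X.mu p)
      ((X.le_op_power_rel_iff p φ _).1 le_rfl) y).trans ?_
    rw [act_apply]
    refine iSup_le fun x => ?_
    refine (mul_le_mul' ((X.ξ_mu_le p x).trans (Th.ext_comp_le _ _ _ _)) le_rfl).trans ?_
    rw [VRel.comp, VRel.iSup_mul]
    refine iSup_le fun z => ?_
    rw [mul_assoc, lowerStar_apply]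
    have h1 := Th.ext_ext_e_le X.ev p z
    have h2 := (mul_le_mul' (Th.ext_map_le (s := Y.rel) (Th.map f.toFun) f.toFun f.isMor z x)
      le_rfl).trans (Y.ext_mul_rel_le _ _ y)
    rw [← Th.map_m] at h2
    refine (mul_le_mul' h1 h2).trans ?_
    refine le_trans (mul_le_mul' (Th.ext_map_le (s := Y.ev) _ f.toFun (fun φ x => ?_) p _) le_rfl)
      (Y.le_mu _ _ y)
    change φ.1 x ≤ act (lowerStar f) φ.1 (f.toFun x)
    rw [act_apply]
    refine le_iSup_of_le (Th.e x) ?_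
    rw [Th.map_e, Th.ξ_e', lowerStar_apply, Th.map_e]
    exact le_trans (le_of_eq (mul_one _).symm) (mul_le_mul' le_rfl (Y.one_le_rel _))

theorem ext_rel₀_e (X : TCat Th) (x y : X.carrier) (z : Th.T.obj X.carrier) :
    Th.ext X.rel₀ (Th.e x) z * X.rel z y ≤ X.rel₀ x y := X.rel₀_ext _ _ _

theorem yoneda_mem (X : TCat Th) (x : X.carrier) :
    TGraph.IsMor ((TGraph.generator Th).tensor X.toTGraph) (TGraph.quantale Th)
      (fun p => X.rel₀ x p.2) := by
  rw [mem_power_iff X (X.rel₀ x)]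
  intro z y
  have h := Th.ext_precomp (fun _ : PUnit.{u + 1} => x) X.rel₀ (Th.e PUnit.unit) z
  rw [Th.map_e] at h
  have h2 := (ext_const PUnit.unit (X.rel₀ x) (Th.e PUnit.unit) z).symm.trans h
  rw [h2]
  exact X.ext_rel₀_e x y z

/-- The Yoneda functor `y_X : X → VX, x ↦ a₀(x, -)`. -/
noncomputable def yoneda (X : TCat Th) : X ⟶ X.vietoris where
  toFun := fun x => ⟨X.rel₀ x, X.yoneda_mem x⟩
  isMor := fun x y => by
    refine (X.le_op_power_rel_iff _ _ _).2 fun z => ?_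
    have h1 : X.rel₀ y z * X.rel x y ≤ X.rel x z := by
      rw [mul_comm]
      exact X.rel_map_e x y z
    refine h1.trans ?_
    refine le_trans ?_ (X.le_mu _ x z)
    refine le_trans (le_of_eq (one_mul _).symm) (mul_le_mul' ?_ le_rfl)
    have h2 := Th.one_le_ext X.rel₀ X.one_le_rel x
    refine h2.trans ?_
    have h3 := Th.ext_map_le (r := X.rel₀) (s := X.ev)
      (fun x => (⟨X.rel₀ x, X.yoneda_mem x⟩ : X.power.carrier)) (fun x => x)
      (fun _ _ => le_rfl) x x
    rwa [Th.map_id] at h3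

theorem upperStar_yoneda (X : TCat Th) : upperStar X.yoneda = X.mu := by
  funext p x
  refine (VRel.conv_graph_comp _ _ _ _).trans ?_
  apply le_antisymm
  · have h := (X.le_op_power_rel_iff p (X.yoneda.toFun x) _).1 le_rfl x
    refine le_trans ?_ h
    refine le_trans (le_of_eq (one_mul _).symm) (mul_le_mul' ?_ le_rfl)
    exact X.one_le_rel x
  · refine (X.le_op_power_rel_iff _ _ _).2 fun y => ?_
    change X.rel₀ x y * X.mu p x ≤ _
    rw [mul_comm]
    refine (VRel.iSup_mul _ _).le.trans ?_
    refine iSup_le fun z => ?_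
    rw [mul_assoc]
    exact (mul_le_mul' le_rfl (X.rel_map_e z x y)).trans (X.le_mu _ _ _)

theorem upperStar_dist (X : TCat Th) (P : Th.T.obj (Th.T.obj X.vietoris.carrier))
    (y : Th.T.obj X.carrier) (z : X.carrier) :
    Th.ext (upperStar X.yoneda) P y * X.rel y z ≤ upperStar X.yoneda (Th.m P) z := by
  rw [upperStar_yoneda]
  exact X.ext_mu_mul_le P y z

/-- The `𝕋`-functor `(y_X)^⊛ ∘ - : VVX → VX`. -/
noncomputable def yonedaMult (X : TCat Th) : X.vietoris.vietoris ⟶ X.vietoris where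
  toFun := fun Φ => ⟨act (upperStar X.yoneda) Φ.1, act_mem _ X.upperStar_dist _⟩
  isMor := fun P Φ => by
    refine (X.le_op_power_rel_iff _ _ _).2 fun y => ?_
    refine (mul_act_le (upperStar X.yoneda) _ Φ.1 (X.vietoris.mu P)
      ((X.vietoris.le_op_power_rel_iff P Φ _).1 le_rfl) y).trans ?_
    rw [act_apply]
    refine iSup_le fun p => ?_
    refine (mul_le_mul' ((X.vietoris.ξ_mu_le P p).trans (Th.ext_comp_le _ _ _ _)) le_rfl).trans ?_
    rw [VRel.comp, VRel.iSup_mul]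
    refine iSup_le fun z => ?_
    rw [mul_assoc]
    have h1 := Th.ext_ext_e_le X.vietoris.ev P z
    have h2 : Th.ext X.vietoris.rel z p * upperStar X.yoneda p y ≤ X.mu (Th.m z) y := by
      rw [upperStar_yoneda]
      exact X.ext_op_mul_mu_le z p y
    refine (mul_le_mul' h1 h2).trans ?_
    rw [mu, VRel.comp, VRel.mul_iSup]
    refine iSup_le fun x => ?_
    rw [← mul_assoc]
    refine (mul_le_mul' (Th.ext_mul_le _ _ _ _ _) le_rfl).trans ?_
    have h3 := Th.ext_map_le (r := VRel.comp X.ev X.vietoris.ev) (s := X.ev)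
      (fun Φ => (⟨act (upperStar X.yoneda) Φ.1, act_mem _ X.upperStar_dist _⟩ :
        X.power.carrier)) (fun x => x) (fun Φ x => ?_) P x
    · rw [Th.map_id] at h3
      exact (mul_le_mul' h3 le_rfl).trans (X.le_mu _ _ _)
    · refine iSup_le fun φ => ?_
      change _ ≤ act (upperStar X.yoneda) Φ.1 x
      rw [act_apply]
      refine le_iSup_of_le (Th.e φ) (mul_le_mul' (Th.ξ_map_e Φ.1 φ).ge ?_)
      rw [upperStar_yoneda]
      exact (X.mu_e φ x).ge

end TCat

section Monads

variable (Th) [Subsingleton (Th.T.obj PUnit.{u + 1})]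

/-- The data of the monad `𝕍 = (V, y, (y_X)^⊛ ∘ -)` on `Cat(𝕋)`. -/
noncomputable def vietorisData : MonadData (TCat Th) where
  obj := TCat.vietoris
  map := TCat.vietorisMap
  unit := TCat.yoneda
  mult := TCat.yonedaMult

/-- The data of `𝕍` restricts to the subcategory `Repr(𝕋)` of `Cat(𝕋)`. -/
structure VietorisRestricts : Prop where
  obj : ∀ X : TCat Th, X.IsRepresentable → X.vietoris.IsRepresentable
  map : ∀ {X Y : TCat Th}, X.IsRepresentable → Y.IsRepresentable → ∀ f : X ⟶ Y,
    TCat.IsPseudoHom f → TCat.IsPseudoHom (TCat.vietorisMap f)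
  unit : ∀ X : TCat Th, X.IsRepresentable → TCat.IsPseudoHom X.yoneda
  mult : ∀ X : TCat Th, X.IsRepresentable → TCat.IsPseudoHom X.yonedaMult

variable {Th}

/-- The data of the monad `𝕍` on `Repr(𝕋)`. -/
noncomputable def vietorisReprData (h : VietorisRestricts Th) : MonadData (TRepr Th) where
  obj X := ⟨X.toTCat.vietoris, h.obj _ X.isRepresentable⟩
  map {X Y} f := ⟨TCat.vietorisMap f.hom,
    h.map X.isRepresentable Y.isRepresentable f.hom f.isPseudoHom⟩
  unit X := ⟨X.toTCat.yoneda, h.unit _ X.isRepresentable⟩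
  mult X := ⟨X.toTCat.yonedaMult, h.mult _ X.isRepresentable⟩

end Monads

end Vietoris

/-! ### Functoriality of the extension `T_ξ` -/

namespace TopologicalTheory

variable {V : Type u} [CommMonoid V] [CompleteLattice V] [IsQuantale V] (Th : TopologicalTheory V)
variable {X Y Z : Type u}

/-! Since `T1 = 1`, a point of `VX` is a distributor from the one-point set to `X`, that is, a map
`φ` with `ξ·Tφ(𝔵) ⊗ a(𝔵, x) ≤ φ(x)`, and convolution with a fixed distributor `ψ` acts on such
points as `act ψ`. Both `Vf` and `n_X` have this form, for `ψ = f_⊛` and for `ψ = mu = a · T_ξ ev`;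
the latter equals `(y_X)^⊛` by the Yoneda lemma. The relation `mu` also controls the structure of
`VX`, whose value at `(𝔭, φ)` is `⋀ₓ hom(φ(x), mu(𝔭, x))`, and it satisfies `mu · e = ev`.

Monad laws. Let `ψ` be compatible with the structure of its source, `ψ ∘ a ≤ ψ`. Functoriality of
`T_ξ` shows that acting by `f_⊛` and then by `ψ` is acting by `ψ · Tf` (`act_act_lowerStar`), and
that acting by `mu` and then by `ψ` is acting by `ψ · T_ξ ev` (`act_act_mu`). Naturality of `n`, the
unit law for `Vy` and associativity thereby reduce to `mu · T(Vf) = f_⊛ · T_ξ ev`, `mu · Ty = a` and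
`mu · Tn = mu · T_ξ ev`. Naturality of `y` and the other unit law are instances of the Yoneda-type
formula `act_rel₀`.

Kock–Zöberlein property. Dualisation makes the order of `VX` the reversed pointwise order, so both
adjunctions become pointwise estimates of suprema; the other halves are the unit laws.

Representability. `X` is representable exactly when `a = a₀ · α` for some `𝕋`-functor `α : TX → X`.
The structure of `VX` always factors in this way through `𝔭 ↦ mu(𝔭, -)`, so only functoriality of
this map is at stake. It follows from `mu_m_le`: the weak pullback property of `m` lifts elements of
`TX` to `TTX`, and `Tα` pushes them back to `TX`. The same device gives `comp_ext_ev_le_act_mu`,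
from which `Vf` and `n_X` are seen to be pseudo-homomorphisms. -/

theorem ext_comp (r : X → Y → V) (s : Y → Z → V) (x : Th.T.obj X) (z : Th.T.obj Z) :
    Th.ext (VRel.comp s r) x z = VRel.comp (Th.ext s) (Th.ext r) x z :=
  le_antisymm (Th.ext_comp_le r s x z) (iSup_le fun y => Th.ext_mul_le r s x y z)

theorem one_le_ext_map (r : X → Y → V) (f : Z → X) (g : Z → Y) (h : ∀ z, 1 ≤ r (f z) (g z))
    (z : Th.T.obj Z) : 1 ≤ Th.ext r (Th.map f z) (Th.map g z) := by
  rw [← Th.ξ_map_one z]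
  exact (Th.ξ_le h z).trans (Th.le_ext r f g z)

end TopologicalTheory

namespace TCat

variable {V : Type u} [CommMonoid V] [CompleteLattice V] [IsQuantale V]
variable {Th : TopologicalTheory V}

theorem le_one_mul_of_one_le {a b : V} (h : 1 ≤ a) : b ≤ a * b :=
  (one_mul b).ge.trans (mul_le_mul' h le_rfl)

theorem le_mul_one_of_one_le {a b : V} (h : 1 ≤ a) : b ≤ b * a :=
  (mul_one b).ge.trans (mul_le_mul' le_rfl h)

/-! ### Left adjoints of the unit of `𝕋` -/

/-- With `isAdjoint_of_rel_eq`, this replaces adjointness to `e_X` by a factorisation of the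
structure, which is how representability is used throughout. -/
theorem rel_eq_of_isAdjoint {X : TCat Th} {α : X.T ⟶ X} (h : IsAdjoint α X.unitT)
    (w : Th.T.obj X.carrier) (x : X.carrier) : X.rel w x = X.rel₀ (α.toFun w) x := by
  apply le_antisymm
  · have h1 : 1 ≤ X.rel₀ (α.toFun (Th.e x)) x := (le_iff _ _).1 h.2 x
    have h2 : X.rel w x ≤ X.T.rel (Th.e w) (Th.e x) := by
      rw [T_rel]
      exact (Th.le_ext_e _ _ _).trans (X.le_hat _ _)
    have h3 := α.isMor (Th.e w) (Th.e x)
    rw [Th.map_e] at h3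
    exact (h2.trans h3).trans ((le_mul_one_of_one_le h1).trans (X.rel_map_e _ _ _))
  -- The adjunction unit at `w` only bounds a supremum over `z` with `m z = w`; by transitivity each
  -- term is at most `a(w, α w)`.
  · have h1 : 1 ≤ X.T.rel (Th.e w) (Th.e (α.toFun w)) := (le_iff _ _).1 h.1 w
    rw [T_rel, Th.m_e, hat_apply] at h1
    have h2 : 1 ≤ X.rel w (α.toFun w) := by
      refine h1.trans (iSup_le fun z => iSup_le fun hz => ?_)
      subst hz
      exact (le_mul_one_of_one_le (X.one_le_rel _)).trans (X.ext_mul_rel_le z _ _)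
    exact (le_one_mul_of_one_le h2).trans (X.rel_map_e _ _ _)

theorem isAdjoint_of_rel_eq {X : TCat Th} {α : X.T ⟶ X}
    (h : ∀ w x, X.rel w x = X.rel₀ (α.toFun w) x) : IsAdjoint α X.unitT := by
  constructor
  · refine (le_iff _ _).2 fun w => ?_
    change 1 ≤ X.T.rel (Th.e w) (Th.e (α.toFun w))
    rw [T_rel]
    refine le_trans ?_ ((Th.le_ext_e _ _ _).trans (X.le_hat _ _))
    rw [h]
    exact X.one_le_rel _
  · refine (le_iff _ _).2 fun x => ?_
    change 1 ≤ X.rel₀ (α.toFun (Th.e x)) x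
    rw [← h]
    exact X.one_le_rel _

theorem one_le_rel_adjoint {X : TCat Th} {α : X.T ⟶ X} (h : IsAdjoint α X.unitT)
    (w : Th.T.obj X.carrier) : 1 ≤ X.rel w (α.toFun w) := by
  rw [rel_eq_of_isAdjoint h]
  exact X.one_le_rel _

/-- In `TX` the relation from `W` to `m W` is at least `k`; functoriality of `α` carries this to `k
≤ a(Tα W, α(m W))`. This is the half of the algebra law for `α` that the lifting arguments need. -/
theorem rel_m_le_rel_map_adjoint {X : TCat Th} {α : X.T ⟶ X} (h : IsAdjoint α X.unitT)
    (W : Th.T.obj (Th.T.obj X.carrier)) (x : X.carrier) :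
    X.rel (Th.m W) x ≤ X.rel (Th.map α.toFun W) x := by
  have h1 : 1 ≤ X.T.rel W (Th.m W) := by
    rw [T_rel]
    exact X.one_le_hat _
  rw [rel_eq_of_isAdjoint h (Th.m W)]
  exact (le_one_mul_of_one_le (h1.trans (α.isMor _ _))).trans (X.rel_map_e _ _ _)

/-- The comparison `β · Tf ≤ f · α` holds for every `𝕋`-functor, so only the opposite one has to be
tested, and it can be phrased without `β`. -/
theorem isPseudoHom_of_rel_le {X Y : TCat Th} {f : X ⟶ Y}
    (h : ∀ α : X.T ⟶ X, IsAdjoint α X.unitT → ∀ w y,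
      Y.rel (Th.map f.toFun w) y ≤ Y.rel₀ (f.toFun (α.toFun w)) y) : IsPseudoHom f := by
  intro α β hα hβ
  constructor
  · refine (le_iff _ _).2 fun w => ?_
    change 1 ≤ Y.rel₀ (β.toFun (Th.map f.toFun w)) (f.toFun (α.toFun w))
    rw [← rel_eq_of_isAdjoint hβ]
    exact (one_le_rel_adjoint hα w).trans (f.isMor _ _)
  · exact (le_iff _ _).2 fun w => (one_le_rel_adjoint hβ (Th.map f.toFun w)).trans (h α hα w _)

/-- Replace `m` by `Tβ` in `Y` using `rel_m_le_rel_map_adjoint`, then replace `β · Tf` by `f · α`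
under `T`. The result says that `f_⊛` meets the hypothesis of `comp_ext_ev_le_act_mu`. -/
theorem IsPseudoHom.rel_le {X Y : TCat Th} {f : X ⟶ Y} (hf : IsPseudoHom f) {α : X.T ⟶ X}
    (hα : IsAdjoint α X.unitT) {β : Y.T ⟶ Y} (hβ : IsAdjoint β Y.unitT)
    (W : Th.T.obj (Th.T.obj X.carrier)) (y : Y.carrier) :
    Y.rel (Th.map f.toFun (Th.m W)) y ≤ Y.rel (Th.map f.toFun (Th.map α.toFun W)) y := by
  have h1 := rel_m_le_rel_map_adjoint hβ (Th.map (Th.map f.toFun) W) y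
  rw [← Th.map_m, Th.map_map] at h1
  rw [Th.map_map]
  refine h1.trans (le_trans (le_one_mul_of_one_le ?_) (Y.rel₀_ext _ _ _))
  exact Th.one_le_ext_map _ _ _ ((le_iff _ _).1 (hf α β hα hβ).2) W

/-! ### Composition of distributors -/

variable [hT : Subsingleton (Th.T.obj PUnit.{u + 1})]

/-- A row of `r` is its restriction along a point `1 → A`, and `T1 = 1` identifies `ξ · T` of a map
with `T_ξ` of a relation from the point. Thus statements about `ξ` become statements about `T_ξ`,
where functoriality is available. -/
theorem ξ_map_eq_ext {A Y : Type u} (r : A → Y → V) (a : A) (y : Th.T.obj Y) :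
    Th.ξ (Th.map (r a) y) = Th.ext r (Th.e a) y := by
  have h := Th.ext_precomp (fun _ : PUnit.{u + 1} => a) r (Th.e PUnit.unit) y
  rwa [Th.map_e, ext_const PUnit.unit (r a)] at h

theorem ξ_map_act {Y Z : Type u} (ψ : Th.T.obj Y → Z → V) (φ : Y → V) (z : Th.T.obj Z) :
    Th.ξ (Th.map (act ψ φ) z) =
      ⨆ P : Th.T.obj (Th.T.obj Y), Th.ξ (Th.map φ (Th.m P)) * Th.ext ψ P z := by
  have h : act ψ φ = VRel.comp ψ (fun (_ : PUnit.{u + 1}) y => Th.ξ (Th.map φ y)) PUnit.unit := by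
    funext z
    exact act_apply ψ φ z
  rw [h, ξ_map_eq_ext, Th.ext_comp]
  refine iSup_congr fun P => ?_
  rw [ext_const PUnit.unit, Th.ξ_map_ξ']

theorem le_act {Y Z : Type u} (ψ : Th.T.obj Y → Z → V) (φ : Y → V) (y : Th.T.obj Y) (z : Z) :
    Th.ξ (Th.map φ y) * ψ y z ≤ act ψ φ z := by
  rw [act_apply]
  exact le_iSup (fun y => Th.ξ (Th.map φ y) * ψ y z) y

theorem act_le {Y Z : Type u} {ψ : Th.T.obj Y → Z → V} {φ : Y → V} {z : Z} {c : V}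
    (h : ∀ y, Th.ξ (Th.map φ y) * ψ y z ≤ c) : act ψ φ z ≤ c := by
  rw [act_apply]
  exact iSup_le h

theorem act_mono {Y Z : Type u} {ψ ψ' : Th.T.obj Y → Z → V} {z : Z} (h : ∀ y, ψ y z ≤ ψ' y z)
    (φ : Y → V) : act ψ φ z ≤ act ψ' φ z :=
  act_le fun y => (mul_le_mul' le_rfl (h y)).trans (le_act ψ' φ y z)

theorem act_rel (X : TCat Th) (φ : X.power.carrier) : act X.rel φ.1 = φ.1 := by
  funext x
  apply le_antisymm
  · exact act_le fun y => (mem_power_iff X φ.1).1 φ.2 y x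
  · refine le_trans ?_ (le_act _ _ (Th.e x) x)
    rw [Th.ξ_map_e]
    exact le_mul_one_of_one_le (X.one_le_rel x)

theorem lowerStar_eq {X Y : TCat Th} (f : X ⟶ Y) :
    lowerStar f = fun x y => Y.rel (Th.map f.toFun x) y := by
  funext x y
  exact lowerStar_apply f x y

theorem lowerStar_id (X : TCat Th) : lowerStar (𝟙 X) = X.rel := by
  funext x y
  rw [lowerStar_apply]
  exact congrArg (fun t => X.rel t y) (Th.map_id x)

theorem le_act_lowerStar {X Y : TCat Th} (f : X ⟶ Y) (φ : X.carrier → V) (x : X.carrier) :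
    φ x ≤ act (lowerStar f) φ (f.toFun x) := by
  refine le_trans ?_ (le_act _ _ (Th.e x) _)
  rw [Th.ξ_map_e, lowerStar_apply, Th.map_e]
  exact le_mul_one_of_one_le (Y.one_le_rel _)

theorem ext_mul_rel_map_le {X Y : TCat Th} (f : X ⟶ Y) (P : Th.T.obj (Th.T.obj X.carrier))
    (x : Th.T.obj X.carrier) (y : Y.carrier) :
    Th.ext X.rel P x * Y.rel (Th.map f.toFun x) y ≤ Y.rel (Th.map f.toFun (Th.m P)) y := by
  rw [Th.map_m]
  exact (mul_le_mul' (Th.ext_map_le (Th.map f.toFun) f.toFun f.isMor P x) le_rfl).trans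
    (Y.ext_mul_rel_le _ _ _)

theorem ext_mul_lowerStar_le {X Y : TCat Th} (f : X ⟶ Y) (P : Th.T.obj (Th.T.obj X.carrier))
    (x : Th.T.obj X.carrier) (y : Y.carrier) :
    Th.ext X.rel P x * lowerStar f x y ≤ lowerStar f (Th.m P) y := by
  rw [lowerStar_apply, lowerStar_apply]
  exact ext_mul_rel_map_le f P x y

/-- In terms of convolution, `ψ ∘ f_⊛ = ψ · Tf`: the structure of `Y` inside `f_⊛` is absorbed by
`ψ`, and conversely `φ` is dominated by its image under `f_⊛` read along `f`. -/
theorem act_act_lowerStar {X Y : TCat Th} {Z : Type u} {ψ : Th.T.obj Y.carrier → Z → V}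
    (hψ : ∀ P y z, Th.ext Y.rel P y * ψ y z ≤ ψ (Th.m P) z) (f : X ⟶ Y) (φ : X.carrier → V) :
    act ψ (act (lowerStar f) φ) = act (fun x => ψ (Th.map f.toFun x)) φ := by
  funext z
  apply le_antisymm
  · refine act_le fun y => ?_
    rw [ξ_map_act, VRel.iSup_mul]
    refine iSup_le fun P => ?_
    rw [mul_assoc, lowerStar_eq, Th.ext_precomp]
    refine (mul_le_mul' le_rfl (hψ _ _ _)).trans ?_
    rw [← Th.map_m]
    exact le_act (fun x => ψ (Th.map f.toFun x)) φ (Th.m P) z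
  · refine act_le fun x => le_trans (mul_le_mul' ?_ le_rfl) (le_act _ _ (Th.map f.toFun x) z)
    rw [Th.map_map]
    exact Th.ξ_le (le_act_lowerStar f φ) x

/-- A Yoneda-type formula: acting on a representable point evaluates `ψ` at that point. -/
theorem act_rel₀ {X : TCat Th} {Z : Type u} {ψ : Th.T.obj X.carrier → Z → V}
    (hψ : ∀ P x z, Th.ext X.rel P x * ψ x z ≤ ψ (Th.m P) z) (x : X.carrier) :
    act ψ (X.rel₀ x) = ψ (Th.e x) := by
  funext z
  apply le_antisymm
  · refine act_le fun y => ?_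
    have h : Th.ext X.rel₀ (Th.e x) y = Th.ext X.rel (Th.map Th.e (Th.e x)) y :=
      Th.ext_precomp Th.e X.rel _ _
    rw [ξ_map_eq_ext, h]
    refine (hψ _ _ _).trans (le_of_eq ?_)
    rw [Th.m_map_e]
  · refine le_trans (le_one_mul_of_one_le ?_) (le_act _ _ (Th.e x) z)
    rw [Th.ξ_map_e]
    exact X.one_le_rel x

theorem ext_mu_map_e (X : TCat Th) (p : Th.T.obj X.power.carrier) (x : Th.T.obj X.carrier) :
    Th.ext X.mu (Th.map Th.e p) x = Th.ext X.ev p x := by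
  rw [← Th.ext_precomp]
  congr 1
  funext φ x
  exact X.mu_e φ x

theorem ext_mu_mul_le_comp {X : TCat Th} {Z : Type u} {ψ : Th.T.obj X.carrier → Z → V}
    (hψ : ∀ P x z, Th.ext X.rel P x * ψ x z ≤ ψ (Th.m P) z)
    (P : Th.T.obj (Th.T.obj X.power.carrier)) (x : Th.T.obj X.carrier) (z : Z) :
    Th.ext X.mu P x * ψ x z ≤ VRel.comp ψ (Th.ext X.ev) (Th.m P) z := by
  refine (mul_le_mul' (Th.ext_comp_le _ _ P x) le_rfl).trans ?_
  rw [VRel.comp, VRel.iSup_mul]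
  refine iSup_le fun W => ?_
  rw [mul_assoc]
  exact (mul_le_mul' (Th.ext_ext_le _ _ _) (hψ _ _ _)).trans
    (le_iSup (fun x => Th.ext X.ev (Th.m P) x * ψ x z) (Th.m W))

/-- The analogue of `act_act_lowerStar` for `mu = a · T_ξ ev`: the factor `a` is absorbed by `ψ`,
leaving `ψ · T_ξ ev`. -/
theorem act_act_mu {X : TCat Th} {Z : Type u} {ψ : Th.T.obj X.carrier → Z → V}
    (hψ : ∀ P x z, Th.ext X.rel P x * ψ x z ≤ ψ (Th.m P) z) (Φ : X.power.carrier → V) :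
    act ψ (act X.mu Φ) = act (VRel.comp ψ (Th.ext X.ev)) Φ := by
  funext z
  apply le_antisymm
  · refine act_le fun x => ?_
    rw [ξ_map_act, VRel.iSup_mul]
    refine iSup_le fun P => ?_
    rw [mul_assoc]
    exact (mul_le_mul' le_rfl (ext_mu_mul_le_comp hψ P x z)).trans (le_act _ Φ _ z)
  · refine act_le fun p => ?_
    rw [VRel.comp, VRel.mul_iSup]
    refine iSup_le fun x => ?_
    rw [← mul_assoc]
    refine le_trans (mul_le_mul' ?_ le_rfl) (le_act _ _ x z)
    rw [ξ_map_act]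
    -- This witness lies over `p` since `m · Te = 1`, and `mu · e = ev` turns `T_ξ mu` at it into
    -- `T_ξ ev` at `p`.
    refine le_iSup_of_le (Th.map Th.e p) ?_
    rw [Th.m_map_e, ext_mu_map_e]

/-- The common half of the formulas for `mu · T(Vf)` and `mu · Tn`. It uses only that `ψ` absorbs
the structure of its target; the reverse inequalities are obtained separately for each `ψ`. -/
theorem mu_map_act_le {X Y : TCat Th} {ψ : Th.T.obj X.carrier → Y.carrier → V}
    (hψ : ∀ P y z, Th.ext ψ P y * Y.rel y z ≤ ψ (Th.m P) z)
    (N : X.power.carrier → Y.power.carrier) (hN : ∀ φ, (N φ).1 = act ψ φ.1)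
    (p : Th.T.obj X.power.carrier) (y : Y.carrier) :
    Y.mu (Th.map N p) y ≤ VRel.comp ψ (Th.ext X.ev) p y := by
  refine iSup_le fun z => ?_
  -- Writing evaluation after `N` as the composite of `T_ξ ev · e` with `ψ` allows `T_ξ` to be
  -- applied factorwise; `m · Te = 1` later removes the extra unit.
  have h : (fun φ z => Y.ev (N φ) z) =
      VRel.comp ψ (fun (φ : X.power.carrier) x => Th.ext X.ev (Th.e φ) x) := by
    funext φ z
    refine (congrFun (hN φ) z).trans ((act_apply _ _ _).trans (iSup_congr fun x => ?_))
    exact congrArg (· * ψ x z) (ξ_map_eq_ext X.ev φ x)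
  rw [← Th.ext_precomp, h, Th.ext_comp, VRel.comp, VRel.iSup_mul]
  refine iSup_le fun W => ?_
  rw [mul_assoc, Th.ext_precomp]
  refine (mul_le_mul' (Th.ext_ext_le _ _ _) (hψ _ _ _)).trans ?_
  rw [Th.m_map_e]
  exact le_iSup (fun x => Th.ext X.ev p x * ψ x y) (Th.m W)

theorem mu_map_vietorisMap {X Y : TCat Th} (f : X ⟶ Y) (p : Th.T.obj X.power.carrier)
    (y : Y.carrier) :
    Y.mu (Th.map (vietorisMap f).toFun p) y = VRel.comp (lowerStar f) (Th.ext X.ev) p y := by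
  apply le_antisymm
  · exact mu_map_act_le (lowerStar_dist f) _ (fun _ => rfl) p y
  · refine iSup_le fun x => ?_
    rw [lowerStar_apply]
    refine le_trans (mul_le_mul' ?_ le_rfl) (Y.le_mu _ (Th.map f.toFun x) y)
    exact Th.ext_map_le _ _ (fun φ x => le_act_lowerStar f φ.1 x) p x

theorem yonedaMult_apply (X : TCat Th) (Φ : X.vietoris.vietoris.carrier) :
    (X.yonedaMult.toFun Φ).1 = act X.mu Φ.1 :=
  congrArg (fun ψ => act ψ Φ.1) X.upperStar_yoneda

theorem mu_map_yonedaMult (X : TCat Th) (P : Th.T.obj X.vietoris.power.carrier)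
    (x : X.carrier) :
    X.mu (Th.map X.yonedaMult.toFun P) x = VRel.comp X.mu (Th.ext X.vietoris.ev) P x := by
  apply le_antisymm
  · exact mu_map_act_le (X := X.vietoris) (Y := X) X.ext_mu_mul_le _ X.yonedaMult_apply P x
  · refine iSup_le fun p => ?_
    rw [mu, VRel.comp, VRel.mul_iSup]
    refine iSup_le fun y => ?_
    rw [← mul_assoc]
    refine le_trans (mul_le_mul' ?_ le_rfl) (X.le_mu _ y x)
    refine (Th.ext_mul_le _ _ _ _ _).trans ?_
    -- The pointwise estimate is `Φ(φ) ⊗ φ(x) ≤ n(Φ)(x)`, witnessed by the summand at `e φ`.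
    have h := Th.ext_map_le (r := VRel.comp X.ev X.vietoris.ev) (s := X.ev)
      X.yonedaMult.toFun (fun x => x) (fun Φ x => ?_) P y
    · rwa [Th.map_id] at h
    · refine iSup_le fun φ => ?_
      refine le_trans ?_ (le_act _ _ (Th.e φ) x)
      rw [upperStar_yoneda, X.mu_e, Th.ξ_map_e]
      exact le_rfl

/-- Evaluation along `y_X` is `a₀`, and `a` absorbs `T_ξ a₀`. -/
theorem mu_map_yoneda (X : TCat Th) (x : Th.T.obj X.carrier) (y : X.carrier) :
    X.mu (Th.map X.yoneda.toFun x) y = X.rel x y := by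
  have h : ∀ z, Th.ext X.ev (Th.map X.yoneda.toFun x) z = Th.ext X.rel₀ x z := fun z =>
    (Th.ext_precomp X.yoneda.toFun X.ev x z).symm
  apply le_antisymm
  · refine iSup_le fun z => ?_
    rw [h]
    exact X.rel₀_ext _ _ _
  · refine le_trans (le_one_mul_of_one_le ?_) (X.le_mu _ x y)
    rw [h]
    exact Th.one_le_ext _ X.one_le_rel x

/-! ### The monad laws -/

theorem hom_vietoris_ext {X Y : TCat Th} {f g : X ⟶ Y.vietoris}
    (h : ∀ x, (f.toFun x).1 = (g.toFun x).1) : f = g :=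
  Hom.ext (funext fun x => Subtype.ext (h x))

theorem vietorisMap_id (X : TCat Th) : vietorisMap (𝟙 X) = 𝟙 X.vietoris := by
  refine hom_vietoris_ext fun φ => ?_
  change act (lowerStar (𝟙 X)) φ.1 = φ.1
  rw [lowerStar_id, act_rel]

theorem vietorisMap_comp {X Y Z : TCat Th} (f : X ⟶ Y) (g : Y ⟶ Z) :
    vietorisMap (f ≫ g) = vietorisMap f ≫ vietorisMap g := by
  refine hom_vietoris_ext fun φ => ?_
  refine Eq.trans ?_ (act_act_lowerStar (ext_mul_lowerStar_le g) f φ.1).symm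
  change act (lowerStar (f ≫ g)) φ.1 = _
  congr 1
  funext x z
  rw [lowerStar_apply, lowerStar_apply, Th.map_map]
  rfl

theorem yoneda_naturality {X Y : TCat Th} (f : X ⟶ Y) :
    f ≫ Y.yoneda = X.yoneda ≫ vietorisMap f := by
  refine hom_vietoris_ext fun x => ?_
  refine Eq.trans ?_ (act_rel₀ (ext_mul_lowerStar_le f) x).symm
  funext y
  rw [lowerStar_apply, Th.map_e]
  rfl

theorem yonedaMult_naturality {X Y : TCat Th} (f : X ⟶ Y) :
    vietorisMap (vietorisMap f) ≫ Y.yonedaMult = X.yonedaMult ≫ vietorisMap f := by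
  refine hom_vietoris_ext fun Φ => ?_
  refine (yonedaMult_apply Y _).trans ?_
  refine (act_act_lowerStar (Y := Y.vietoris) Y.ext_op_mul_mu_le (vietorisMap f) Φ.1).trans ?_
  refine Eq.trans ?_ (congrArg (act (lowerStar f)) (yonedaMult_apply X Φ)).symm
  rw [act_act_mu (ext_mul_lowerStar_le f)]
  congr 1
  funext p y
  exact mu_map_vietorisMap f p y

theorem yoneda_yonedaMult (X : TCat Th) : X.vietoris.yoneda ≫ X.yonedaMult = 𝟙 X.vietoris := by
  refine hom_vietoris_ext fun φ => ?_
  refine (yonedaMult_apply X _).trans ?_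
  refine (act_rel₀ (X := X.vietoris) X.ext_op_mul_mu_le φ).trans ?_
  funext x
  exact X.mu_e φ x

theorem vietorisMap_yoneda_yonedaMult (X : TCat Th) :
    vietorisMap X.yoneda ≫ X.yonedaMult = 𝟙 X.vietoris := by
  refine hom_vietoris_ext fun φ => ?_
  refine (yonedaMult_apply X _).trans ?_
  refine (act_act_lowerStar (Y := X.vietoris) X.ext_op_mul_mu_le X.yoneda φ.1).trans ?_
  refine Eq.trans ?_ (act_rel X φ)
  congr 1
  funext x y
  exact X.mu_map_yoneda x y

theorem yonedaMult_assoc (X : TCat Th) :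
    vietorisMap X.yonedaMult ≫ X.yonedaMult = X.vietoris.yonedaMult ≫ X.yonedaMult := by
  refine hom_vietoris_ext fun Ψ => ?_
  refine (yonedaMult_apply X _).trans ?_
  refine (act_act_lowerStar (Y := X.vietoris) X.ext_op_mul_mu_le X.yonedaMult Ψ.1).trans ?_
  refine Eq.trans ?_ (yonedaMult_apply X _).symm
  refine Eq.trans ?_ (congrArg (act X.mu) (yonedaMult_apply X.vietoris Ψ)).symm
  refine Eq.trans ?_ (act_act_mu (X := X.vietoris) X.ext_op_mul_mu_le Ψ.1).symm
  congr 1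
  funext P x
  exact X.mu_map_yonedaMult P x

/-! ### The Kock-Zöberlein property -/

/-- The reversal of the pointwise order comes from dualising `V^X`; it fixes the direction of both
adjunctions. -/
theorem one_le_vietoris_rel₀_iff (X : TCat Th) (φ ψ : X.vietoris.carrier) :
    1 ≤ X.vietoris.rel₀ φ ψ ↔ ∀ x, ψ.1 x ≤ φ.1 x := by
  refine (X.le_op_power_rel_iff (Th.e φ) ψ 1).trans (forall_congr' fun x => ?_)
  rw [mul_one, X.mu_e]

theorem vietorisMap_mono {X Y : TCat Th} {f g : X ⟶ Y} (h : f ≤ g) :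
    vietorisMap f ≤ vietorisMap g := by
  refine (le_iff _ _).2 fun φ => (one_le_vietoris_rel₀_iff Y _ _).2 fun y => ?_
  refine act_mono (fun x => ?_) φ.1
  rw [lowerStar_apply, lowerStar_apply]
  exact (le_one_mul_of_one_le (Th.one_le_ext_map _ _ _ ((le_iff _ _).1 h) x)).trans
    (Y.rel₀_ext _ _ _)

theorem yoneda_isAdjoint (X : TCat Th) : IsAdjoint X.vietoris.yoneda X.yonedaMult := by
  refine ⟨(X.yoneda_yonedaMult).ge, (le_iff _ _).2 fun Φ =>
    (one_le_vietoris_rel₀_iff X.vietoris _ _).2 fun φ => ?_⟩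
  -- By residuation the claim is `φ(x) ⊗ Φ(φ) ≤ n(Φ)(x)`, again the summand at `e φ`.
  refine (X.le_op_power_rel_iff _ _ _).2 fun x => ?_
  rw [X.mu_e, yonedaMult_apply]
  refine le_trans ?_ (le_act _ _ (Th.e φ) x)
  rw [Th.ξ_map_e, X.mu_e, mul_comm]
  exact le_rfl

theorem yonedaMult_isAdjoint (X : TCat Th) : IsAdjoint X.yonedaMult (vietorisMap X.yoneda) := by
  refine ⟨(le_iff _ _).2 fun Φ => (one_le_vietoris_rel₀_iff X.vietoris _ _).2 fun φ => ?_,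
    (X.vietorisMap_yoneda_yonedaMult).le⟩
  change act (lowerStar X.yoneda) (X.yonedaMult.toFun Φ).1 φ ≤ Φ.1 φ
  rw [yonedaMult_apply, act_act_mu (ext_mul_lowerStar_le X.yoneda)]
  -- The point `Φ` is fixed by the action of the structure of `VX`, so it suffices to bound `(y_X)_⊛
  -- · T_ξ ev` by that structure. After residuation, `mu · Ty = a` reduces the bound to the
  -- definition of `mu`.
  refine le_trans (act_mono (fun p => ?_) Φ.1) (congrFun (act_rel X.vietoris Φ) φ).le
  refine iSup_le fun x => (X.le_op_power_rel_iff _ _ _).2 fun z => ?_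
  rw [mul_left_comm, lowerStar_apply]
  refine (mul_le_mul' le_rfl ((X.le_op_power_rel_iff _ φ _).1 le_rfl z)).trans ?_
  rw [mu_map_yoneda]
  exact X.le_mu _ _ _

/-! ### Representability -/

theorem vietoris_rel (X : TCat Th) (p : Th.T.obj X.vietoris.carrier) (φ : X.vietoris.carrier) :
    X.vietoris.rel p φ = X.vietoris.rel₀ ⟨X.mu p, X.mu_mem p⟩ φ := by
  refine (X.op_power_rel p φ).trans (Eq.trans ?_ (X.op_power_rel _ φ).symm)
  simp only [X.mu_e]

/-- The key inequality for representability of `VX`: it makes `𝔭 ↦ mu(𝔭, -)` a `𝕋`-functor. An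
element `y` of `TX` related to `m P` is lifted along `m` to `W` in `TTX` and then replaced by `Tα
W`; the last step costs nothing in `a` by `rel_m_le_rel_map_adjoint`. -/
theorem mu_m_le {X : TCat Th} (hX : X.IsRepresentable)
    (P : Th.T.obj (Th.T.obj X.power.carrier)) (x : X.carrier) :
    X.mu (Th.m P) x ≤ X.mu (Th.map (fun p => (⟨X.mu p, X.mu_mem p⟩ : X.power.carrier)) P) x := by
  obtain ⟨α, hα⟩ := hX
  have h : ∀ y, Th.ext X.ev (Th.map (fun p => (⟨X.mu p, X.mu_mem p⟩ : X.power.carrier)) P) y =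
      Th.ext X.mu P y := fun y => (Th.ext_precomp _ X.ev P y).symm
  refine iSup_le fun y => (mul_le_mul' (Th.ext_m_le _ _ _) le_rfl).trans ?_
  simp only [VRel.iSup_mul]
  refine iSup_le fun W => iSup_le fun hW => ?_
  subst hW
  refine le_trans ?_ (X.le_mu _ (Th.map α.toFun W) x)
  rw [h]
  refine mul_le_mul' ?_ (rel_m_le_rel_map_adjoint hα W x)
  -- Since `k ≤ a(w, α w)` throughout, `T_ξ a` relates `W` to `Tα W` with value at least `k`.
  -- Composing with it turns the inner `T_ξ ev` into `mu`.
  have h1 := Th.one_le_ext_map X.rel (fun w => w) α.toFun (one_le_rel_adjoint hα) W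
  rw [Th.map_id] at h1
  exact (le_mul_one_of_one_le h1).trans (Th.ext_mul_le _ _ _ _ _)

/-- The algebra structure `T(VX) → VX, 𝔭 ↦ a · T_ξ ev (𝔭)` of a representable `𝕋`-category `X`. -/
def muHom {X : TCat Th} (hX : X.IsRepresentable) : X.vietoris.T ⟶ X.vietoris where
  toFun := fun p => ⟨X.mu p, X.mu_mem p⟩
  isMor := fun P p => by
    refine (X.le_op_power_rel_iff _ _ _).2 fun x => le_trans ?_ (mu_m_le hX P x)
    rw [T_rel, hat_apply]
    simp only [VRel.mul_iSup]
    refine iSup_le fun Z => iSup_le fun hZ => ?_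
    rw [← hZ, mul_comm]
    exact X.ext_op_mul_mu_le Z p x

theorem muHom_isAdjoint {X : TCat Th} (hX : X.IsRepresentable) :
    IsAdjoint (muHom hX) X.vietoris.unitT :=
  isAdjoint_of_rel_eq X.vietoris_rel

/-- Left adjoints are in general unique only up to equivalence; here they agree strictly because the
order of `VX` is antisymmetric. An arbitrary adjoint can thus be replaced by the explicit one. -/
theorem toFun_eq_mu_of_isAdjoint {X : TCat Th} {β : X.vietoris.T ⟶ X.vietoris}
    (hβ : IsAdjoint β X.vietoris.unitT) (p : Th.T.obj X.vietoris.carrier) :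
    (β.toFun p).1 = X.mu p := by
  have h : ∀ φ, X.vietoris.rel₀ (β.toFun p) φ = X.vietoris.rel₀ ⟨X.mu p, X.mu_mem p⟩ φ := fun φ =>
    (rel_eq_of_isAdjoint hβ p φ).symm.trans (X.vietoris_rel p φ)
  funext x
  refine le_antisymm ((one_le_vietoris_rel₀_iff X ⟨X.mu p, X.mu_mem p⟩ (β.toFun p)).1 ?_ x)
    ((one_le_vietoris_rel₀_iff X (β.toFun p) ⟨X.mu p, X.mu_mem p⟩).1 ?_ x)
  · rw [← h]
    exact X.vietoris.one_le_rel _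
  · rw [h]
    exact X.vietoris.one_le_rel _

/-- The lifting argument of `mu_m_le` applied to `𝔭 = m(e 𝔭)`, with `ψ` in place of `a`. It
expresses that acting by `ψ` is compatible with the algebra structure `mu`, provided `ψ` is
compatible with `α`. -/
theorem comp_ext_ev_le_act_mu {X : TCat Th} {Z : Type u} {ψ : Th.T.obj X.carrier → Z → V}
    {α : X.T ⟶ X} (hα : IsAdjoint α X.unitT) {z : Z}
    (hψ : ∀ W, ψ (Th.m W) z ≤ ψ (Th.map α.toFun W) z) (p : Th.T.obj X.power.carrier) :
    VRel.comp ψ (Th.ext X.ev) p z ≤ act ψ (X.mu p) z := by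
  refine iSup_le fun x => ?_
  have h := Th.ext_m_le X.ev (Th.e p) x
  rw [Th.m_e] at h
  refine (mul_le_mul' h le_rfl).trans ?_
  simp only [VRel.iSup_mul]
  refine iSup_le fun W => iSup_le fun hW => ?_
  subst hW
  refine le_trans (mul_le_mul' ?_ (hψ W)) (le_act _ _ (Th.map α.toFun W) z)
  have h1 := Th.one_le_ext_map X.rel (fun w => w) α.toFun (one_le_rel_adjoint hα) W
  rw [Th.map_id] at h1
  rw [ξ_map_eq_ext]
  exact (le_mul_one_of_one_le h1).trans (Th.ext_mul_le _ _ _ _ _)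

/-- By residuation, the criterion `isPseudoHom_of_rel_le` becomes a pointwise inequality when the
codomain is some `VY`. -/
theorem isPseudoHom_of_mu_map_le {X Y : TCat Th} {f : X ⟶ Y.vietoris}
    (h : ∀ α : X.T ⟶ X, IsAdjoint α X.unitT → ∀ w y,
      Y.mu (Th.map f.toFun w) y ≤ (f.toFun (α.toFun w)).1 y) : IsPseudoHom f := by
  refine isPseudoHom_of_rel_le fun α hα w φ => (Y.le_op_power_rel_iff _ _ _).2 fun y => ?_
  rw [Y.mu_e]
  exact ((Y.le_op_power_rel_iff _ _ _).1 le_rfl y).trans (h α hα w y)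

theorem isPseudoHom_yoneda (X : TCat Th) : IsPseudoHom X.yoneda := by
  refine isPseudoHom_of_mu_map_le fun α hα w y => ?_
  rw [mu_map_yoneda]
  exact (rel_eq_of_isAdjoint hα w y).le

theorem isPseudoHom_vietorisMap {X Y : TCat Th} (hX : X.IsRepresentable) (hY : Y.IsRepresentable)
    {f : X ⟶ Y} (hf : IsPseudoHom f) : IsPseudoHom (vietorisMap f) := by
  obtain ⟨α, hα⟩ := hX
  obtain ⟨β, hβ⟩ := hY
  refine isPseudoHom_of_mu_map_le fun γ hγ p y => ?_
  change _ ≤ act (lowerStar f) (γ.toFun p).1 y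
  rw [mu_map_vietorisMap, toFun_eq_mu_of_isAdjoint hγ]
  refine comp_ext_ev_le_act_mu hα (fun W => ?_) p
  rw [lowerStar_apply, lowerStar_apply]
  exact hf.rel_le hα hβ W y

theorem isPseudoHom_yonedaMult {X : TCat Th} (hX : X.IsRepresentable) :
    IsPseudoHom X.yonedaMult := by
  refine isPseudoHom_of_mu_map_le fun γ hγ P x => ?_
  rw [mu_map_yonedaMult, yonedaMult_apply, toFun_eq_mu_of_isAdjoint hγ]
  -- Here the representable category is `VX` with algebra structure `mu`, and `mu` is also the
  -- acting distributor, so the compatibility required is `mu_m_le` itself.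
  exact comp_ext_ev_le_act_mu (X := X.vietoris) (muHom_isAdjoint hX)
    (fun W => mu_m_le hX W x) P

end TCat

/-! ### The monads on `Cat(𝕋)` and `Repr(𝕋)` -/

section Monads

variable {V : Type u} [CommMonoid V] [CompleteLattice V] [IsQuantale V]
variable (Th : TopologicalTheory V) [Subsingleton (Th.T.obj PUnit.{u + 1})]

/-- The monad `𝕍` on `Cat(𝕋)`. -/
noncomputable def vietorisMonad : Monad (TCat Th) where
  obj := TCat.vietoris
  map := TCat.vietorisMap
  map_id := TCat.vietorisMap_id
  map_comp := TCat.vietorisMap_comp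
  η := { app := TCat.yoneda, naturality := fun _ _ f => TCat.yoneda_naturality f }
  μ := { app := TCat.yonedaMult, naturality := fun _ _ f => TCat.yonedaMult_naturality f }
  assoc := TCat.yonedaMult_assoc
  left_unit := TCat.yoneda_yonedaMult
  right_unit := TCat.vietorisMap_yoneda_yonedaMult

theorem vietorisRestricts : VietorisRestricts Th where
  obj _ hX := ⟨_, TCat.muHom_isAdjoint hX⟩
  map hX hY _ hf := TCat.isPseudoHom_vietorisMap hX hY hf
  unit X _ := X.isPseudoHom_yoneda
  mult _ hX := TCat.isPseudoHom_yonedaMult hX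

variable {Th}

/-- The monad `𝕍` on `Repr(𝕋)`. -/
noncomputable def vietorisReprMonad (h : VietorisRestricts Th) : Monad (TRepr Th) where
  obj := (vietorisReprData h).obj
  map := (vietorisReprData h).map
  map_id X := TRepr.Hom.ext (TCat.vietorisMap_id X.toTCat)
  map_comp f g := TRepr.Hom.ext (TCat.vietorisMap_comp f.hom g.hom)
  η :=
    { app := (vietorisReprData h).unit
      naturality := fun _ _ f => TRepr.Hom.ext (TCat.yoneda_naturality f.hom) }
  μ :=
    { app := (vietorisReprData h).mult
      naturality := fun _ _ f => TRepr.Hom.ext (TCat.yonedaMult_naturality f.hom) }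
  assoc X := TRepr.Hom.ext (TCat.yonedaMult_assoc X.toTCat)
  left_unit X := TRepr.Hom.ext (TCat.yoneda_yonedaMult X.toTCat)
  right_unit X := TRepr.Hom.ext (TCat.vietorisMap_yoneda_yonedaMult X.toTCat)

variable (Th) in
theorem isKockZoberlein_vietorisMonad : IsKockZoberlein (vietorisMonad Th) :=
  ⟨fun _ _ _ _ h => TCat.vietorisMap_mono h,
    fun X => ⟨X.yoneda_isAdjoint, X.yonedaMult_isAdjoint⟩⟩

/-- The order on pseudo-homomorphisms is inherited from `Cat(𝕋)`, and all arrows of the two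
adjunctions are pseudo-homomorphisms, so the inequalities transfer unchanged. -/
theorem isKockZoberlein_vietorisReprMonad (h : VietorisRestricts Th) :
    IsKockZoberlein (vietorisReprMonad h) :=
  ⟨fun _ _ _ _ h => TCat.vietorisMap_mono h,
    fun X => ⟨X.toTCat.yoneda_isAdjoint, X.toTCat.yonedaMult_isAdjoint⟩⟩

end Monads

theorem mainTheorem1 {V : Type u} [CommMonoid V] [CompleteLattice V] [IsQuantale V]
    (hV : (⊥ : V) ≠ 1) (Th : TopologicalTheory V) [Subsingleton (Th.T.obj PUnit.{u + 1})] :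
    (∃ M : Monad (TCat Th), M.data = vietorisData Th ∧ IsKockZoberlein M) ∧
    ∃ h : VietorisRestricts Th, ∃ M : Monad (TRepr Th),
      M.data = vietorisReprData h ∧ IsKockZoberlein M :=
  ⟨⟨vietorisMonad Th, rfl, isKockZoberlein_vietorisMonad Th⟩, vietorisRestricts Th,
    vietorisReprMonad (vietorisRestricts Th), rfl, isKockZoberlein_vietorisReprMonad _⟩
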